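/- Let $n\in\{1,2\}$, $B=[-1,1)^n$, and identify $B$ with the torus $\mathbb{R}^n/2\mathbb{Z}^n$; the subscript $\pi$ denotes periodic (real-valued) functions and gradients are distributional gradients on the torus. Let $\Gamma=\{\pm\frac12\}$ if $n=1$, and let $\Gamma$ be a smooth (regular, simple) closed curve on the torus if $n=2$; let $d(x,\Gamma)$ be the distance on the torus. Let $\sigma\in[0,1)$ and let $\alpha:\mathbb{R}^n\to\mathbb{R}$ be measurable and periodic with $$\tfrac1c\,d(x,\Gamma)^\sigma\le\alpha(x)\le c\,d(x,\Gamma)^\sigma\quad\text{for all }x$$ for some $1\le c<\infty$ (with $0^0=1$). Let $$\mathrm{H}^1_{\pi,\alpha}(B)=\{u\in \mathrm{L}^2_\pi(B): |\nabla u|\in \mathrm{L}^1_\pi(B),\ \sqrt\alpha\,\nabla u\in \mathrm{L}^2_\pi(B)\},\qquad \|u\|_{\mathrm{H}^1_{\pi,\alpha}}=\bigl(\|u\|_2^2+\|\sqrt\alpha\nabla u\|_2^2\bigr)^{1/2},$$ let $E_\alpha(u)=\int_B\alpha|\nabla u|^2\,dx$ for $u\in \mathrm{H}^1_{\pi,\alpha}(B)$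 and $E_\alpha(u)=\infty$ for $u\in \mathrm{L}^2_\pi(B)\setminus \mathrm{H}^1_{\pi,\alpha}(B)$, and, for $m\ge1$, let $E^m_\alpha(u)=\int_B(\frac1m+\alpha)|\nabla u|^2\,dx$ for $u\in \mathrm{H}^1_\pi(B)$ and $E^m_\alpha(u)=\infty$ for $u\in \mathrm{L}^2_\pi(B)\setminus \mathrm{H}^1_\pi(B)$. Then $E^m_\alpha$ $\Gamma$-converges to $E_\alpha$ as $m\to\infty$ with respect to the weak topology of $\mathrm{H}^1_{\pi,\alpha}(B)$, i.e. (i) $E_\alpha(u)\le\liminf_{m\to\infty}E^m_\alpha(u_m)$ whenever $u,u_m\in \mathrm{H}^1_{\pi,\alpha}(B)$ and $u_m\rightharpoonup u$ in $\mathrm{H}^1_{\pi,\alpha}(B)$; (ii) for every $u\in \mathrm{H}^1_{\pi,\alpha}(B)$ there are $u_m\in \mathrm{H}^1_{\pi}(B)\cap\mathrm{H}^1_{\pi,\alpha}(B)$ with $u_m\rightharpoonup u$ in $\mathrm{H}^1_{\pi,\alpha}(B)$ and $E^m_\alpha(u_m)\to E_\alpha(u)$. Moreover, in (ii) one can take $u_m=\varphi_m*u$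 (periodic convolution), where $\varphi_m(x)=m^n\varphi(mx)$ and $\varphi$ is any smooth, nonnegative, radial, radially decreasing function on $\mathbb{R}^n$ with support in $B$ and $\int\varphi=1$. -/

import Mathlib

open MeasureTheory Filter Topology Set
open scoped ENNReal ContDiff

noncomputable section

namespace DegenerateEnergy

/-- Euclidean space `ℝⁿ`. -/
abbrev E (n : ℕ) : Type := EuclideanSpace ℝ (Fin n)

/-- The periodicity box `B = [-1,1)ⁿ`. -/
def box (n : ℕ) : Set (E n) := {x | ∀ i, x i ∈ Ico (-1 : ℝ) 1}

/-- Lebesgue measure on the box `B`. -/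
def boxMeasure (n : ℕ) : Measure (E n) := volume.restrict (box n)

/-- The period lattice `2ℤⁿ`; the torus is `ℝⁿ / 2ℤⁿ`, with fundamental domain `B`. -/
def lattice (n : ℕ) : Set (E n) := {v | ∃ k : Fin n → ℤ, ∀ i, v i = 2 * (k i : ℝ)}

/-- Periodic functions on `ℝⁿ`, i.e. functions on the torus. -/
def IsPeriodic {n : ℕ} (f : E n → ℝ) : Prop := ∀ x, ∀ v ∈ lattice n, f (x + v) = f x

/-- The representative in `B` of a point of `ℝⁿ` modulo `2ℤⁿ`. -/
def reduce {n : ℕ} (x : E n) : E n :=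
  WithLp.toLp 2 (fun i => toIcoMod (two_pos : (0 : ℝ) < 2) (-1) (x i))

/-! ### The degeneration set and the coefficients -/

/-- The degeneration set: the points `±1/2` if `n = 1`; a smooth (regular, simple) closed curve
on the torus if `n = 2`, given by a parametrization that is closed and injective modulo the
lattice. A smooth simple closed plane curve contained in `B` is a special case. -/
def IsDegenerationSet (n : ℕ) (Γ : Set (E n)) : Prop :=
  (n = 1 ∧ Γ = {x | (∀ i, x i = 1 / 2) ∨ (∀ i, x i = -(1 / 2))}) ∨
  (n = 2 ∧ ∃ γ : ℝ → E n, ContDiff ℝ ∞ γ ∧ (∀ t, deriv γ t ≠ 0) ∧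
    (∀ s t, γ s - γ t ∈ lattice n ↔ ∃ k : ℤ, s - t = (k : ℝ)) ∧ Γ = range γ)

/-- Distance on the torus from `x` to `Γ`: the distance of `x` to all lattice translates
of `Γ`. -/
def torusDist {n : ℕ} (Γ : Set (E n)) (x : E n) : ℝ :=
  Metric.infDist x {y | ∃ p ∈ Γ, y - p ∈ lattice n}

/-- Periodic coefficients `α` with `c⁻¹ d(x,Γ)^σ ≤ α(x) ≤ c d(x,Γ)^σ`. -/
structure IsDiffusivity {n : ℕ} (σ : ℝ) (Γ : Set (E n)) (α : E n → ℝ) : Prop where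
  measurable : Measurable α
  periodic : IsPeriodic α
  bounds : ∃ c : ℝ, 1 ≤ c ∧
    ∀ x, 1 / c * torusDist Γ x ^ σ ≤ α x ∧ α x ≤ c * torusDist Γ x ^ σ

/-! ### Periodic Sobolev spaces -/

/-- `L²_π(B)`. -/
abbrev L2 (n : ℕ) : Type := Lp ℝ 2 (boxMeasure n)

/-- Periodic test functions `C^∞_π(B)`. -/
def IsTest {n : ℕ} (ψ : E n → ℝ) : Prop := ContDiff ℝ ∞ ψ ∧ IsPeriodic ψ

/-- The `i`-th partial derivative of a differentiable function. -/
def partialDeriv {n : ℕ} (i : Fin n) (ψ : E n → ℝ) (x : E n) : ℝ :=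
  fderiv ℝ ψ x (EuclideanSpace.single i 1)

/-- The distributional gradient of `u` on the torus is the integrable function `g`. -/
def IsWeakGrad {n : ℕ} (u : L2 n) (g : E n → E n) : Prop :=
  Integrable g (boxMeasure n) ∧
  ∀ ψ : E n → ℝ, IsTest ψ → ∀ i : Fin n,
    ∫ x, u x * partialDeriv i ψ x ∂(boxMeasure n) = - ∫ x, g x i * ψ x ∂(boxMeasure n)

open Classical in
/-- The gradient `∇u` of a function `u` whose distributional gradient is integrable
(it is unique almost everywhere in `B`). -/
def weakGrad {n : ℕ} (u : L2 n) : E n → E n :=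
  if h : ∃ g, IsWeakGrad u g then h.choose else 0

/-- `u ∈ H¹_π(B)`: both `u` and `∇u` are square integrable. -/
def MemH1 {n : ℕ} (u : L2 n) : Prop :=
  ∃ g : E n → E n, IsWeakGrad u g ∧ MemLp g 2 (boxMeasure n)

theorem isFiniteMeasure_boxMeasure (n : ℕ) : IsFiniteMeasure (boxMeasure n) := by
  refine ⟨?_⟩
  have hb : Bornology.IsBounded (box n) := by
    have h : box n ⊆ (PiLp.continuousLinearEquiv 2 ℝ (fun _ : Fin n => ℝ)).symm ''
        (Icc (fun _ => (-1 : ℝ)) (fun _ => 1)) := by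
      intro x hx
      exact ⟨fun i => x i, ⟨fun i => (hx i).1, fun i => (hx i).2.le⟩, rfl⟩
    exact (isCompact_Icc.image
      (PiLp.continuousLinearEquiv 2 ℝ (fun _ : Fin n => ℝ)).symm.continuous).isBounded.subset h
  simpa [boxMeasure] using hb.measure_lt_top

theorem exists_bound_of_continuous {n : ℕ} {f : E n → ℝ} (hf : Continuous f) :
    ∃ C, ∀ᵐ x ∂(boxMeasure n), ‖f x‖ ≤ C := by
  have hK : IsCompact ((PiLp.continuousLinearEquiv 2 ℝ (fun _ : Fin n => ℝ)).symm ''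
        (Icc (fun _ => (-1 : ℝ)) (fun _ => 1))) :=
    isCompact_Icc.image (PiLp.continuousLinearEquiv 2 ℝ (fun _ : Fin n => ℝ)).symm.continuous
  obtain ⟨C, hC⟩ := hK.exists_bound_of_continuousOn hf.continuousOn
  have hm : MeasurableSet (box n) := by
    have : box n = ⋂ i, (fun x : E n => x i) ⁻¹' Ico (-1 : ℝ) 1 := by
      ext x; simp [box]
    rw [this]
    exact MeasurableSet.iInter fun i =>
      (by fun_prop : Measurable fun x : E n => x i) measurableSet_Ico
  refine ⟨C, ?_⟩
  rw [boxMeasure, ae_restrict_iff' hm]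
  exact Eventually.of_forall fun x hx =>
    hC x ⟨fun i => x i, ⟨fun i => (hx i).1, fun i => (hx i).2.le⟩, rfl⟩

theorem integrable_mul_continuous {n : ℕ} {f h : E n → ℝ} (hf : Integrable f (boxMeasure n))
    (hh : Continuous h) : Integrable (fun x => f x * h x) (boxMeasure n) := by
  obtain ⟨C, hC⟩ := exists_bound_of_continuous hh
  exact hf.mul_bdd hh.aestronglyMeasurable hC

theorem integrable_L2 {n : ℕ} (u : L2 n) : Integrable (fun x => u x) (boxMeasure n) := by
  have := isFiniteMeasure_boxMeasure n
  exact (Lp.memLp u).integrable (by norm_num)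

theorem integrable_coord {n : ℕ} {g : E n → E n} (hg : Integrable g (boxMeasure n))
    (i : Fin n) : Integrable (fun x => g x i) (boxMeasure n) :=
  (EuclideanSpace.proj (𝕜 := ℝ) i).integrable_comp hg

theorem IsTest.continuous_partialDeriv {n : ℕ} {ψ : E n → ℝ} (h : IsTest ψ) (i : Fin n) :
    Continuous (partialDeriv i ψ) :=
  (h.1.continuous_fderiv (by simp)).clm_apply continuous_const

theorem IsWeakGrad.add {n : ℕ} {u v : L2 n} {g k : E n → E n} (hu : IsWeakGrad u g)
    (hv : IsWeakGrad v k) : IsWeakGrad (u + v) (g + k) := by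
  refine ⟨hu.1.add hv.1, fun ψ hψ i => ?_⟩
  have e : ∫ x, (u + v : L2 n) x * partialDeriv i ψ x ∂(boxMeasure n) =
      ∫ x, (u x * partialDeriv i ψ x + v x * partialDeriv i ψ x) ∂(boxMeasure n) := by
    refine integral_congr_ae ?_
    filter_upwards [Lp.coeFn_add u v] with x hx
    rw [hx, Pi.add_apply, add_mul]
  have hd := hψ.continuous_partialDeriv i
  have hc := hψ.1.continuous
  rw [e, integral_add (integrable_mul_continuous (integrable_L2 u) hd)
    (integrable_mul_continuous (integrable_L2 v) hd), hu.2 ψ hψ i, hv.2 ψ hψ i, ← neg_add,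
    ← integral_add (integrable_mul_continuous (integrable_coord hu.1 i) hc)
      (integrable_mul_continuous (integrable_coord hv.1 i) hc)]
  simp [add_mul]

theorem IsWeakGrad.smul {n : ℕ} {u : L2 n} {g : E n → E n} (a : ℝ) (hu : IsWeakGrad u g) :
    IsWeakGrad (a • u) (a • g) := by
  refine ⟨hu.1.smul a, fun ψ hψ i => ?_⟩
  have e : ∫ x, (a • u : L2 n) x * partialDeriv i ψ x ∂(boxMeasure n) =
      ∫ x, a * (u x * partialDeriv i ψ x) ∂(boxMeasure n) := by
    refine integral_congr_ae ?_
    filter_upwards [Lp.coeFn_smul a u] with x hx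
    rw [hx, Pi.smul_apply, smul_eq_mul, mul_assoc]
  rw [e, integral_const_mul, hu.2 ψ hψ i]
  simp [mul_assoc, integral_const_mul]

theorem isWeakGrad_zero (n : ℕ) : IsWeakGrad (0 : L2 n) 0 := by
  refine ⟨integrable_zero _ _ _, fun ψ hψ i => ?_⟩
  have e : ∫ x, (0 : L2 n) x * partialDeriv i ψ x ∂(boxMeasure n) = 0 := by
    refine integral_eq_zero_of_ae ?_
    filter_upwards [Lp.coeFn_zero ℝ 2 (boxMeasure n)] with x hx
    rw [hx]; simp
  rw [e]; simp

/-- The weighted space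
`H¹_{π,α}(B) = {u ∈ L²_π(B) : |∇u| ∈ L¹_π(B), √α ∇u ∈ L²_π(B)}`. -/
def H1w {n : ℕ} (α : E n → ℝ) : Submodule ℝ (L2 n) where
  carrier := {u | ∃ g : E n → E n, IsWeakGrad u g ∧
    MemLp (fun x => √(α x) • g x) 2 (boxMeasure n)}
  zero_mem' := ⟨0, isWeakGrad_zero n, by simp⟩
  add_mem' := by
    rintro u v ⟨g, hg, hg'⟩ ⟨k, hk, hk'⟩
    exact ⟨g + k, hg.add hk, by simpa [smul_add, Pi.add_def] using hg'.add hk'⟩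
  smul_mem' := by
    rintro a u ⟨g, hg, hg'⟩
    refine ⟨a • g, hg.smul a, ?_⟩
    have := hg'.const_smul a
    simpa [Pi.smul_def, smul_comm a] using this

/-- The norm `(‖u‖₂² + ‖√α ∇u‖₂²)^{1/2}` of `H¹_{π,α}(B)`. -/
def normH1w {n : ℕ} (α : E n → ℝ) (u : H1w α) : ℝ :=
  √(‖(u : L2 n)‖ ^ 2 + ∫ x, ‖√(α x) • weakGrad (u : L2 n) x‖ ^ 2 ∂(boxMeasure n))

/-- The dual of `H¹_{π,α}(B)`: the linear functionals bounded with respect to its norm. -/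
def DualH1w {n : ℕ} (α : E n → ℝ) : Type :=
  {ℓ : H1w α →ₗ[ℝ] ℝ // ∃ C : ℝ, ∀ v, |ℓ v| ≤ C * normH1w α v}

/-- The weak topology of `H¹_{π,α}(B)`: the coarsest one making every element of the dual
continuous. -/
abbrev weakTopology {n : ℕ} (α : E n → ℝ) : TopologicalSpace (H1w α) :=
  TopologicalSpace.induced (fun u (ℓ : DualH1w α) => ℓ.1 u) Pi.topologicalSpace

/-! ### Energies and Gamma-convergence -/

open Classical in
/-- `E_α(u) = ∫_B α |∇u|² dx` on `H¹_{π,α}(B)`, extended by `∞` to `L²_π(B)`. -/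
def energy {n : ℕ} (α : E n → ℝ) (u : L2 n) : ℝ≥0∞ :=
  if u ∈ H1w α then ∫⁻ x, ENNReal.ofReal (α x * ‖weakGrad u x‖ ^ 2) ∂(boxMeasure n) else ⊤

open Classical in
/-- `E^m_α(u) = ∫_B (1/m + α) |∇u|² dx` on `H¹_π(B)`, extended by `∞` to `L²_π(B)`
(meaningful for `m ≥ 1`). -/
def regEnergy {n : ℕ} (α : E n → ℝ) (m : ℕ) (u : L2 n) : ℝ≥0∞ :=
  if MemH1 u then
    ∫⁻ x, ENNReal.ofReal ((1 / (m : ℝ) + α x) * ‖weakGrad u x‖ ^ 2) ∂(boxMeasure n)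
  else ⊤

/-- (Sequential) Gamma-convergence of `F m` to `F₀`, as `m → ∞`, with respect to the
topology `τ` of `X`: the lower bound along every convergent sequence, and the existence of
recovery sequences. -/
def GammaConverges {X : Type*} (τ : TopologicalSpace X) (F : ℕ → X → ℝ≥0∞)
    (F₀ : X → ℝ≥0∞) : Prop :=
  (∀ (u : X) (v : ℕ → X), Tendsto v atTop (@nhds X τ u) →
    F₀ u ≤ liminf (fun m => F m (v m)) atTop) ∧
  (∀ u : X, ∃ v : ℕ → X, Tendsto v atTop (@nhds X τ u) ∧
    Tendsto (fun m => F m (v m)) atTop (𝓝 (F₀ u)))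

/-! ### Mollification -/

/-- Smooth, nonnegative, radial and radially decreasing functions of unit mass with (compact)
support in `B`. -/
structure IsMollifierProfile {n : ℕ} (φ : E n → ℝ) : Prop where
  smooth : ContDiff ℝ ∞ φ
  support : tsupport φ ⊆ box n
  nonneg : ∀ x, 0 ≤ φ x
  radial_anti : ∀ x y, ‖x‖ ≤ ‖y‖ → φ y ≤ φ x
  integral_eq_one : ∫ x, φ x = 1

/-- The mollifier `φ_m(x) = mⁿ φ(m x)`. -/
def mollifier {n : ℕ} (φ : E n → ℝ) (m : ℕ) (x : E n) : ℝ := (m : ℝ) ^ n * φ ((m : ℝ) • x)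

/-- Periodic convolution `∫_B k(x - y) u(y) dy`, the difference being taken modulo `2ℤⁿ`. -/
def periodicConv {n : ℕ} (k : E n → ℝ) (u : L2 n) (x : E n) : ℝ :=
  ∫ y, k (reduce (x - y)) * u y ∂(boxMeasure n)

end DegenerateEnergy

end

/-! Write `G u = √α ∇u`, an `L²` field depending linearly on `u`, so that `E_α(u) = ‖G u‖²`.

Lower bound. `E_α ≤ E^m_α`, and a squared Hilbert norm is weakly lower semicontinuous: `‖G v‖² ≥ 2⟪G
u, G v⟫ - ‖G u‖²`, where `v ↦ ⟪G u, G v⟫` belongs to the dual.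

Recovery sequence. Replace `u` by its average over the translates by `ε s`, where `ε = 1/m` and `s`
follows a probability measure `ν` dominated by a multiple of Lebesgue measure on a ball;
mollification is the case `ν = φ dx`. Averaging commutes with the weak gradient. Everything rests on
two bounds for `V(x) = ∫ α(x - ε s)⁻¹ dν(s)` (`IsDiffusivity.exists_lintegral_inv_le`): `V ≤ K
ε^{-σ}`, and the Muckenhoupt `A₁` type bound `α V ≤ K`. By Cauchy-Schwarz, the squared average of
`f` at `x` is at most `V(x) ∫ α|f|²(x - ε s) dν(s)`. Integrating over the torus, the second bound
makes averaging uniformly bounded on `L²(α dx)`; approximation by continuous functions then gives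
strong convergence of `G u_m`, hence weak convergence and convergence of `E_α(u_m)`. The first bound
gives `(1/m) ∫ |∇u_m|² ≤ K m^{σ-1} E_α(u) → 0`.

To bound `V`, cover the periodized `Γ` in a ball by zero sets of finitely many Lipschitz functions
`h(x) = x_i - F(x)` with `F` independent of `x_i`. Where `d(·,Γ) < 1`, some `|h|` is at most `C d`,
so `d^{-σ}` is dominated by the `|h|^{-σ}`. In the direction `e_i` each `h` has slope one, and
Fubini leaves the one-dimensional integral of `|t|^{-σ}`, finite since `σ < 1`. -/

noncomputable section

namespace DegenerateEnergy

variable {n : ℕ}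

/-! ### Reduction modulo the lattice -/

theorem reduce_apply (x : E n) (i : Fin n) :
    reduce x i = toIcoMod (two_pos : (0 : ℝ) < 2) (-1) (x i) := rfl

theorem reduce_mem_box (x : E n) : reduce x ∈ box n := fun i => by
  have h := toIcoMod_mem_Ico (two_pos : (0 : ℝ) < 2) (-1) (x i)
  rw [reduce_apply]
  exact ⟨h.1, h.2.trans_le (by norm_num)⟩

theorem reduce_eq_of_mem_box {x y : E n} (hy : y ∈ box n) (h : x - y ∈ lattice n) :
    reduce x = y := by
  obtain ⟨k, hk⟩ := h
  ext i
  rw [reduce_apply, toIcoMod_eq_iff]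
  refine ⟨⟨(hy i).1, (hy i).2.trans_le (by norm_num)⟩, k i, ?_⟩
  have h := hk i
  simp only [PiLp.sub_apply] at h
  simp only [zsmul_eq_mul]
  linarith

theorem zero_mem_lattice : (0 : E n) ∈ lattice n := ⟨0, by simp⟩

theorem neg_mem_lattice {v : E n} (hv : v ∈ lattice n) : -v ∈ lattice n := by
  obtain ⟨k, hk⟩ := hv
  exact ⟨-k, fun i => by simp [hk i]⟩

theorem add_mem_lattice {v w : E n} (hv : v ∈ lattice n) (hw : w ∈ lattice n) :
    v + w ∈ lattice n := by
  obtain ⟨k, hk⟩ := hv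
  obtain ⟨l, hl⟩ := hw
  exact ⟨k + l, fun i => by simp [hk i, hl i, mul_add]⟩

theorem reduce_of_mem_box {x : E n} (hx : x ∈ box n) : reduce x = x :=
  reduce_eq_of_mem_box hx (by simpa using zero_mem_lattice)

theorem sub_reduce_mem_lattice (x : E n) : x - reduce x ∈ lattice n := by
  refine ⟨fun i => toIcoDiv (two_pos : (0 : ℝ) < 2) (-1) (x i), fun i => ?_⟩
  rw [PiLp.sub_apply, reduce_apply, self_sub_toIcoMod, zsmul_eq_mul, mul_comm]

theorem reduce_congr {x y : E n} (h : x - y ∈ lattice n) : reduce x = reduce y :=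
  reduce_eq_of_mem_box (reduce_mem_box y) (by
    simpa using add_mem_lattice h (sub_reduce_mem_lattice y))

theorem IsPeriodic.reduce {f : E n → ℝ} (hf : IsPeriodic f) (x : E n) :
    f (reduce x) = f x := by
  simpa using (hf (DegenerateEnergy.reduce x) _ (sub_reduce_mem_lattice x)).symm

theorem reduce_sub_reduce (x y : E n) : reduce (x - reduce y) = reduce (x - y) :=
  reduce_congr (by simpa using sub_reduce_mem_lattice y)

theorem measurable_reduce : Measurable (reduce : E n → E n) := by
  have h : ∀ i : Fin n, Measurable fun x : E n =>
      toIcoMod (two_pos : (0 : ℝ) < 2) (-1) (x i) := fun i => by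
    simp only [toIcoMod_eq_add_fract_mul]
    fun_prop
  exact (WithLp.measurable_toLp 2 _).comp (measurable_pi_lambda _ h)

/-! ### The box as a fundamental domain, and invariance of its measure -/

theorem measurableSet_box (n : ℕ) : MeasurableSet (box n) := by
  have : box n = ⋂ i, (fun x : E n => x i) ⁻¹' Ico (-1 : ℝ) 1 := by
    ext x; simp [box]
  rw [this]
  exact MeasurableSet.iInter fun i =>
    (by fun_prop : Measurable fun x : E n => x i) measurableSet_Ico

instance (n : ℕ) : IsFiniteMeasure (boxMeasure n) := isFiniteMeasure_boxMeasure n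

theorem ae_mem_box (n : ℕ) : ∀ᵐ x ∂boxMeasure n, x ∈ box n :=
  ae_restrict_mem (measurableSet_box n)

/-- The open box `(-1,1)ⁿ`. -/
def openBox (n : ℕ) : Set (E n) := {x | ∀ i, x i ∈ Ioo (-1 : ℝ) 1}

theorem openBox_subset_box (n : ℕ) : openBox n ⊆ box n := fun _ hx i => ⟨(hx i).1.le, (hx i).2⟩

theorem isOpen_openBox (n : ℕ) : IsOpen (openBox n) := by
  have : openBox n = ⋂ i, (fun x : E n => x i) ⁻¹' Ioo (-1 : ℝ) 1 := by
    ext x; simp [openBox]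
  rw [this]
  exact isOpen_iInter_of_finite fun i =>
    isOpen_Ioo.preimage (by fun_prop : Continuous fun x : E n => x i)

theorem ae_mem_openBox (n : ℕ) : ∀ᵐ x ∂boxMeasure n, x ∈ openBox n := by
  have h : ∀ i : Fin n, ∀ᵐ x ∂(volume : Measure (E n)), x i ≠ -1 := fun i => by
    have h1 : ∀ᵐ y ∂(volume : Measure (Fin n → ℝ)), y i ≠ -1 := by
      simp only [ae_iff, ne_eq, not_not, volume_pi]
      exact Measure.pi_hyperplane (fun _ : Fin n => (volume : Measure ℝ)) i (-1)
    exact (PiLp.volume_preserving_ofLp (Fin n)).quasiMeasurePreserving.ae h1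
  filter_upwards [ae_mem_box n, ae_restrict_of_ae (ae_all_iff.2 h)] with x hx hx' i
  exact ⟨lt_of_le_of_ne (hx i).1 (hx' i).symm, (hx i).2⟩

/-- The period lattice as a subgroup. -/
def latticeSubgroup (n : ℕ) : AddSubgroup (E n) where
  carrier := lattice n
  zero_mem' := zero_mem_lattice
  add_mem' := add_mem_lattice
  neg_mem' := neg_mem_lattice

instance (n : ℕ) : Countable (latticeSubgroup n) := by
  have : (lattice n).Countable := by
    refine (countable_range fun k : Fin n → ℤ =>
      (WithLp.toLp 2 fun i => 2 * (k i : ℝ) : E n)).mono ?_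
    rintro v ⟨k, hk⟩
    exact ⟨k, by ext i; simp [hk i]⟩
  exact this.to_subtype

theorem isAddFundamentalDomain_reflect (z : E n) :
    IsAddFundamentalDomain (latticeSubgroup n) ((fun x => z - x) ⁻¹' box n) volume := by
  refine IsAddFundamentalDomain.mk'
    ((measurableSet_box n).preimage (by fun_prop)).nullMeasurableSet fun x => ?_
  refine ⟨⟨z - x - reduce (z - x), sub_reduce_mem_lattice _⟩, ?_, ?_⟩
  · have : z - (z - x - reduce (z - x) + x) = reduce (z - x) := by abel
    simp only [mem_preimage, AddSubgroup.vadd_def, vadd_eq_add, this]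
    exact reduce_mem_box _
  · rintro ⟨g, hg⟩ h
    simp only [mem_preimage, AddSubgroup.vadd_def, vadd_eq_add] at h
    have : reduce (z - x) = z - (g + x) := reduce_eq_of_mem_box h (by
      rw [show z - x - (z - (g + x)) = g by abel]; exact hg)
    ext1
    simp only [this]
    abel

theorem isAddFundamentalDomain_box (n : ℕ) :
    IsAddFundamentalDomain (latticeSubgroup n) (box n) volume := by
  refine IsAddFundamentalDomain.mk' (measurableSet_box n).nullMeasurableSet fun x => ?_
  refine ⟨⟨-(x - reduce x), neg_mem_lattice (sub_reduce_mem_lattice _)⟩, ?_, ?_⟩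
  · simpa [AddSubgroup.vadd_def] using reduce_mem_box x
  · rintro ⟨g, hg⟩ h
    simp only [AddSubgroup.vadd_def, vadd_eq_add] at h
    have : reduce x = g + x := reduce_eq_of_mem_box h (by simpa using neg_mem_lattice hg)
    ext1
    simp only [this]
    abel

/-- Reflections of the torus preserve its measure. -/
theorem measurePreserving_reflect (z : E n) :
    MeasurePreserving (fun x => reduce (z - x)) (boxMeasure n) (boxMeasure n) := by
  have hm : Measurable fun x : E n => reduce (z - x) := measurable_reduce.comp (by fun_prop)
  refine ⟨hm, ?_⟩
  ext s hs
  rw [Measure.map_apply hm hs, ← lintegral_indicator_one (hm hs), ← lintegral_indicator_one hs]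
  set F : E n → ℝ≥0∞ := fun x => s.indicator 1 (reduce x) with hF
  have h1 : ∫⁻ x, ((fun x => reduce (z - x)) ⁻¹' s).indicator 1 x ∂boxMeasure n =
      ∫⁻ x in (fun x => z - x) ⁻¹' box n, F x := by
    rw [← (Measure.measurePreserving_sub_left volume z).setLIntegral_comp_preimage_emb
      (MeasurableEquiv.subLeft z).measurableEmbedding]
    have : (fun x => z - x) ⁻¹' ((fun x => z - x) ⁻¹' box n) = box n := by
      ext x; simp
    rw [this]
    rfl
  have h2 : ∫⁻ x, s.indicator 1 x ∂boxMeasure n = ∫⁻ x in box n, F x := by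
    refine lintegral_congr_ae ?_
    filter_upwards [ae_mem_box n] with x hx
    rw [hF]
    simp only [reduce_of_mem_box hx]
  rw [h1, h2]
  -- A lattice-invariant integrand has the same integral over the box and over the reflected box,
  -- both being fundamental domains.
  refine (isAddFundamentalDomain_reflect z).setLIntegral_eq (isAddFundamentalDomain_box n) F ?_
  intro g x
  have : reduce ((g : E n) + x) = reduce x := reduce_congr (by rw [add_sub_cancel_right]; exact g.2)
  simp [hF, AddSubgroup.vadd_def, this]

/-- Translations of the torus preserve its measure. -/
theorem measurePreserving_translate (z : E n) :
    MeasurePreserving (fun x => reduce (x - z)) (boxMeasure n) (boxMeasure n) := by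
  -- A translation is the composition of two reflections.
  have h := (measurePreserving_reflect (0 : E n)).comp (measurePreserving_reflect z)
  convert h using 1
  ext1 x
  rw [Function.comp_apply, reduce_sub_reduce, zero_sub, neg_sub]

/-- For each fixed second variable the map is a translation of the torus, and `ν` has mass one. This
transfers integrability and integrals from the torus to the pairs `(x, s)`. -/
theorem measurePreserving_translate_prod (ν : Measure (E n)) [IsProbabilityMeasure ν] (ε : ℝ) :
    MeasurePreserving (fun p : E n × E n => reduce (p.1 - ε • p.2))
      ((boxMeasure n).prod ν) (boxMeasure n) := by
  have hm : Measurable fun p : E n × E n => reduce (p.1 - ε • p.2) :=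
    measurable_reduce.comp (by fun_prop)
  refine ⟨hm, ?_⟩
  ext s hs
  rw [Measure.map_apply hm hs, Measure.prod_apply_symm (hm hs)]
  have : ∀ y : E n, boxMeasure n
      ((fun x => (x, y)) ⁻¹' ((fun p : E n × E n => reduce (p.1 - ε • p.2)) ⁻¹' s)) =
      boxMeasure n s := fun y =>
    (measurePreserving_translate (ε • y)).measure_preimage hs.nullMeasurableSet
  simp [this]

/-! ### Uniqueness of the weak gradient -/

/-- The periodic extension of a smooth function compactly supported in the open box. -/
theorem isTest_comp_reduce {f : E n → ℝ} (hf : ContDiff ℝ ∞ f) (hc : HasCompactSupport f)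
    (hs : tsupport f ⊆ openBox n) : IsTest fun x => f (reduce x) := by
  refine ⟨contDiff_iff_contDiffAt.2 fun y => ?_, fun x v hv => ?_⟩
  swap
  · exact congrArg f (reduce_congr (by simpa using hv))
  -- Over the open box, `reduce` is locally a fixed translation. Otherwise `y` lies over a face,
  -- near which the extension vanishes.
  by_cases hy : reduce y ∈ openBox n
  · have ho : IsOpen ((fun x => x - (y - reduce y)) ⁻¹' openBox n) :=
      (isOpen_openBox n).preimage (by fun_prop)
    have he : (fun x => f (reduce x)) =ᶠ[𝓝 y] fun x => f (x - (y - reduce y)) := by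
      filter_upwards [ho.mem_nhds (by simpa using hy)] with x hx
      rw [reduce_eq_of_mem_box (openBox_subset_box n hx) (by
        simpa using sub_reduce_mem_lattice y)]
    exact (hf.comp (contDiff_id.sub contDiff_const)).contDiffAt.congr_of_eventuallyEq he
  · obtain ⟨i, hi⟩ : ∃ i, reduce y i = -1 := by
      by_contra! h
      exact hy fun i => ⟨lt_of_le_of_ne (reduce_mem_box y i).1 (h i).symm, (reduce_mem_box y i).2⟩
    -- The continuous periodic function `cos (π x_i)` detects the face: it is `-1` at `y`, but
    -- avoids `-1` on the compact support of `f`.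
    have hper : ∀ x : E n, Real.cos (Real.pi * reduce x i) = Real.cos (Real.pi * x i) := by
      intro x
      obtain ⟨k, hk⟩ := sub_reduce_mem_lattice x
      have h := hk i
      rw [PiLp.sub_apply] at h
      have : Real.pi * x i = Real.pi * reduce x i + k i * (2 * Real.pi) := by
        rw [← sub_eq_iff_eq_add', ← mul_sub, h]; ring
      rw [this, Real.cos_add_int_mul_two_pi]
    have hcy : Real.cos (Real.pi * y i) = -1 := by
      rw [← hper, hi]; simp
    have hcont : Continuous fun x : E n => Real.cos (Real.pi * x i) := by fun_prop
    have hK : IsClosed ((fun x : E n => Real.cos (Real.pi * x i)) '' tsupport f) :=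
      (hc.isCompact.image hcont).isClosed
    have hny : Real.cos (Real.pi * y i) ∉ (fun x : E n => Real.cos (Real.pi * x i)) '' tsupport f := by
      rintro ⟨x, hx, hxy⟩
      have hx1 := hs hx i
      simp only [hcy] at hxy
      have habs : |Real.pi * x i| < Real.pi := by
        rw [abs_mul, abs_of_pos Real.pi_pos]
        exact mul_lt_of_lt_one_right Real.pi_pos (abs_lt.2 hx1)
      have := Real.cos_lt_cos_of_nonneg_of_le_pi (abs_nonneg _) le_rfl habs
      rw [Real.cos_pi, Real.cos_abs] at this
      linarith
    have he : (fun x => f (reduce x)) =ᶠ[𝓝 y] fun _ => 0 := by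
      filter_upwards [hcont.continuousAt.eventually (hK.isOpen_compl.mem_nhds hny)] with x hx
      by_contra hne
      exact hx ⟨reduce x, subset_tsupport _ hne, hper x⟩
    exact contDiffAt_const.congr_of_eventuallyEq he

/-- Test functions compactly supported in the open box extend periodically, and the rest of the box
is null. -/
theorem ae_eq_zero_of_forall_integral_test {f : E n → ℝ} (hf : Integrable f (boxMeasure n))
    (h : ∀ ψ : E n → ℝ, IsTest ψ → ∫ x, f x * ψ x ∂boxMeasure n = 0) :
    f =ᵐ[boxMeasure n] 0 := by
  have := (isOpen_openBox n).ae_eq_zero_of_integral_contDiff_smul_eq_zero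
    (hf.locallyIntegrable.locallyIntegrableOn _) (μ := boxMeasure n) (f := f) ?_
  · filter_upwards [this, ae_mem_openBox n] with x hx hx' using hx hx'
  intro g hg hc hs
  rw [← h _ (isTest_comp_reduce hg hc hs)]
  refine integral_congr_ae ?_
  filter_upwards [ae_mem_box n] with x hx
  rw [reduce_of_mem_box hx, smul_eq_mul, mul_comm]

/-- Makes the choice in `weakGrad` harmless, and hence `u ↦ √α ∇u` linear. -/
theorem IsWeakGrad.ae_eq {u : L2 n} {g k : E n → E n} (hg : IsWeakGrad u g)
    (hk : IsWeakGrad u k) : g =ᵐ[boxMeasure n] k := by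
  have h : ∀ i : Fin n, ∀ᵐ x ∂boxMeasure n, g x i - k x i = 0 := fun i => by
    refine ae_eq_zero_of_forall_integral_test
      ((integrable_coord hg.1 i).sub (integrable_coord hk.1 i)) fun ψ hψ => ?_
    simp only [sub_mul]
    rw [integral_sub (integrable_mul_continuous (integrable_coord hg.1 i) hψ.1.continuous)
      (integrable_mul_continuous (integrable_coord hk.1 i) hψ.1.continuous)]
    have h1 := hg.2 ψ hψ i
    have h2 := hk.2 ψ hψ i
    linarith
  filter_upwards [ae_all_iff.2 h] with x hx
  ext i
  exact sub_eq_zero.1 (hx i)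

theorem isWeakGrad_weakGrad {u : L2 n} (h : ∃ g, IsWeakGrad u g) : IsWeakGrad u (weakGrad u) := by
  rw [weakGrad, dif_pos h]
  exact h.choose_spec

theorem IsWeakGrad.weakGrad_ae_eq {u : L2 n} {g : E n → E n} (h : IsWeakGrad u g) :
    weakGrad u =ᵐ[boxMeasure n] g :=
  (isWeakGrad_weakGrad ⟨g, h⟩).ae_eq h

theorem IsWeakGrad.congr {u : L2 n} {g k : E n → E n} (h : IsWeakGrad u g)
    (hk : g =ᵐ[boxMeasure n] k) : IsWeakGrad u k := by
  refine ⟨h.1.congr hk, fun ψ hψ i => ?_⟩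
  rw [h.2 ψ hψ i, neg_inj]
  refine integral_congr_ae ?_
  filter_upwards [hk] with x hx
  rw [hx]

/-! ### The weighted gradient as a linear map -/

theorem isWeakGrad_of_H1w {α : E n → ℝ} (u : H1w α) : IsWeakGrad (u : L2 n) (weakGrad (u : L2 n)) := by
  obtain ⟨g, hg, -⟩ := u.2
  exact isWeakGrad_weakGrad ⟨g, hg⟩

theorem memLp_sqrt_smul_weakGrad {α : E n → ℝ} (u : H1w α) :
    MemLp (fun x => √(α x) • weakGrad (u : L2 n) x) 2 (boxMeasure n) := by
  obtain ⟨g, hg, hg'⟩ := u.2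
  refine hg'.ae_eq ?_
  filter_upwards [hg.weakGrad_ae_eq] with x hx
  rw [hx]

/-- The linear map `u ↦ √α ∇u`. -/
def weightedGrad (α : E n → ℝ) : H1w α →ₗ[ℝ] Lp (E n) 2 (boxMeasure n) where
  toFun u := (memLp_sqrt_smul_weakGrad u).toLp _
  map_add' u v := by
    rw [← MemLp.toLp_add, MemLp.toLp_eq_toLp_iff]
    filter_upwards [((isWeakGrad_of_H1w u).add (isWeakGrad_of_H1w v)).weakGrad_ae_eq] with x hx
    have : weakGrad ((u + v : H1w α) : L2 n) x = _ := hx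
    rw [this, Pi.add_apply, Pi.add_apply, smul_add]
  map_smul' a u := by
    rw [RingHom.id_apply, ← MemLp.toLp_const_smul, MemLp.toLp_eq_toLp_iff]
    filter_upwards [((isWeakGrad_of_H1w u).smul a).weakGrad_ae_eq] with x hx
    have : weakGrad ((a • u : H1w α) : L2 n) x = _ := hx
    rw [this, Pi.smul_apply, Pi.smul_apply, smul_comm]

theorem coeFn_weightedGrad {α : E n → ℝ} (u : H1w α) :
    weightedGrad α u =ᵐ[boxMeasure n] fun x => √(α x) • weakGrad (u : L2 n) x :=
  (memLp_sqrt_smul_weakGrad u).coeFn_toLp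

theorem norm_sq_weightedGrad {α : E n → ℝ} (u : H1w α) :
    ‖weightedGrad α u‖ ^ 2 = ∫ x, ‖√(α x) • weakGrad (u : L2 n) x‖ ^ 2 ∂boxMeasure n := by
  rw [← real_inner_self_eq_norm_sq, L2.inner_def]
  refine integral_congr_ae ?_
  filter_upwards [coeFn_weightedGrad u] with x hx
  rw [real_inner_self_eq_norm_sq, hx]

theorem normH1w_eq {α : E n → ℝ} (u : H1w α) :
    normH1w α u = √(‖(u : L2 n)‖ ^ 2 + ‖weightedGrad α u‖ ^ 2) := by
  rw [normH1w, norm_sq_weightedGrad]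

theorem norm_weightedGrad_le {α : E n → ℝ} (u : H1w α) : ‖weightedGrad α u‖ ≤ normH1w α u := by
  rw [normH1w_eq]
  exact Real.le_sqrt_of_sq_le (le_add_of_nonneg_left (sq_nonneg _))

theorem energy_eq {α : E n → ℝ} (h0 : ∀ x, 0 ≤ α x) (u : H1w α) :
    energy α (u : L2 n) = ENNReal.ofReal (‖weightedGrad α u‖ ^ 2) := by
  rw [energy, if_pos u.2, norm_sq_weightedGrad, ofReal_integral_eq_lintegral_ofReal
    ((memLp_two_iff_integrable_sq_norm (memLp_sqrt_smul_weakGrad u).1).1 (memLp_sqrt_smul_weakGrad u))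
    (Eventually.of_forall fun x => sq_nonneg _)]
  refine lintegral_congr fun x => ?_
  rw [norm_smul, mul_pow, Real.norm_of_nonneg (Real.sqrt_nonneg _), Real.sq_sqrt (h0 x)]

theorem energy_le_regEnergy {α : E n → ℝ} (m : ℕ) (u : H1w α) :
    energy α (u : L2 n) ≤ regEnergy α m (u : L2 n) := by
  rw [energy, if_pos u.2, regEnergy]
  split_ifs
  · refine lintegral_mono fun x => ENNReal.ofReal_le_ofReal ?_
    have : (0 : ℝ) ≤ 1 / m := by positivity
    nlinarith [sq_nonneg ‖weakGrad (u : L2 n) x‖, mul_nonneg this (sq_nonneg ‖weakGrad (u : L2 n) x‖)]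
  · exact le_top

/-! ### Weak convergence -/

theorem tendsto_weakTopology_iff {α : E n → ℝ} {v : ℕ → H1w α} {u : H1w α} :
    Tendsto v atTop (@nhds _ (weakTopology α) u) ↔
      ∀ ℓ : DualH1w α, Tendsto (fun m => ℓ.1 (v m)) atTop (𝓝 (ℓ.1 u)) := by
  rw [nhds_induced, tendsto_comap_iff, tendsto_pi_nhds]
  rfl

theorem tendsto_weakTopology_of_norm {α : E n → ℝ} {v : ℕ → H1w α} {u : H1w α}
    (h1 : Tendsto (fun m => (v m : L2 n)) atTop (𝓝 (u : L2 n)))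
    (h2 : Tendsto (fun m => weightedGrad α (v m)) atTop (𝓝 (weightedGrad α u))) :
    Tendsto v atTop (@nhds _ (weakTopology α) u) := by
  refine tendsto_weakTopology_iff.2 fun ℓ => ?_
  obtain ⟨C, hC⟩ := ℓ.2
  have h : Tendsto (fun m => normH1w α (v m - u)) atTop (𝓝 0) := by
    simp only [normH1w_eq, map_sub, Submodule.coe_sub]
    have h3 := ((tendsto_iff_norm_sub_tendsto_zero.1 h1).pow 2).add
      ((tendsto_iff_norm_sub_tendsto_zero.1 h2).pow 2)
    simpa using h3.sqrt
  rw [tendsto_iff_norm_sub_tendsto_zero]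
  refine squeeze_zero (fun _ => norm_nonneg _) (fun m => ?_) (by simpa using h.const_mul C)
  rw [← map_sub]
  exact hC _

/-- The functional `v ↦ ∫ α ∇u · ∇v`. -/
def dirichletFunctional {α : E n → ℝ} (u : H1w α) : DualH1w α :=
  ⟨(innerSL ℝ (weightedGrad α u)).toLinearMap ∘ₗ weightedGrad α, ‖weightedGrad α u‖, fun v =>
    (abs_real_inner_le_norm _ _).trans
      (mul_le_mul_of_nonneg_left (norm_weightedGrad_le v) (norm_nonneg _))⟩

/-- Weak lower semicontinuity of a squared Hilbert norm, tested only against `dirichletFunctional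
u`. -/
theorem energy_le_liminf {α : E n → ℝ} (h0 : ∀ x, 0 ≤ α x) {v : ℕ → H1w α} {u : H1w α}
    (h : Tendsto v atTop (@nhds _ (weakTopology α) u)) :
    energy α (u : L2 n) ≤ liminf (fun m => regEnergy α m (v m : L2 n)) atTop := by
  have h1 : Tendsto (fun m => inner ℝ (weightedGrad α u) (weightedGrad α (v m))) atTop
      (𝓝 (inner ℝ (weightedGrad α u) (weightedGrad α u))) :=
    tendsto_weakTopology_iff.1 h (dirichletFunctional u)
  have h2 := ENNReal.tendsto_ofReal ((h1.const_mul 2).sub_const (‖weightedGrad α u‖ ^ 2))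
  have h3 : 2 * inner ℝ (weightedGrad α u) (weightedGrad α u) - ‖weightedGrad α u‖ ^ 2 =
      ‖weightedGrad α u‖ ^ 2 := by
    rw [real_inner_self_eq_norm_sq]; ring
  rw [h3] at h2
  rw [energy_eq h0, ← h2.liminf_eq]
  refine liminf_le_liminf (Eventually.of_forall fun m => ?_)
  refine le_trans ?_ (energy_le_regEnergy m (v m))
  rw [energy_eq h0]
  refine ENNReal.ofReal_le_ofReal ?_
  -- Nonnegativity of this square is the tangent inequality `2⟪a, b⟫ - ‖a‖² ≤ ‖b‖²`.
  have := norm_sub_sq_real (weightedGrad α u) (weightedGrad α (v m))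
  nlinarith [sq_nonneg ‖weightedGrad α u - weightedGrad α (v m)‖]

/-! ### Averages of translates on the torus -/

section Average

variable {F : Type*} [NormedAddCommGroup F] [NormedSpace ℝ F]

/-- The average `∫ f(x - ε s) dν(s)` of translates of `f` on the torus. -/
def torusAvg (ν : Measure (E n)) (ε : ℝ) (f : E n → F) (x : E n) : F :=
  ∫ s, f (reduce (x - ε • s)) ∂ν

variable {ν : Measure (E n)} [IsProbabilityMeasure ν] {ε : ℝ} {f g : E n → F}

theorem measurable_translate_prod (ε : ℝ) :
    Measurable fun p : E n × E n => reduce (p.1 - ε • p.2) :=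
  measurable_reduce.comp (by fun_prop)

theorem measurable_translate_right (ε : ℝ) (x : E n) :
    Measurable fun s : E n => reduce (x - ε • s) :=
  measurable_reduce.comp (by fun_prop)

theorem integrable_translate_prod {G : Type*} [NormedAddCommGroup G] {f : E n → G}
    (hf : Integrable f (boxMeasure n)) :
    Integrable (fun p : E n × E n => f (reduce (p.1 - ε • p.2))) ((boxMeasure n).prod ν) :=
  ((measurePreserving_translate_prod ν ε).integrable_comp hf.1).2 hf

theorem integrable_torusAvg (hf : Integrable f (boxMeasure n)) :
    Integrable (torusAvg ν ε f) (boxMeasure n) :=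
  (integrable_translate_prod hf).integral_prod_left

theorem ae_integrable_translate {G : Type*} [NormedAddCommGroup G] {f : E n → G}
    (hf : Integrable f (boxMeasure n)) :
    ∀ᵐ x ∂boxMeasure n, Integrable (fun s => f (reduce (x - ε • s))) ν :=
  (integrable_translate_prod hf).prod_right_ae

theorem torusAvg_sub_ae (hf : Integrable f (boxMeasure n)) (hg : Integrable g (boxMeasure n)) :
    torusAvg ν ε (f - g) =ᵐ[boxMeasure n] torusAvg ν ε f - torusAvg ν ε g := by
  filter_upwards [ae_integrable_translate (ν := ν) (ε := ε) hf,
    ae_integrable_translate (ν := ν) (ε := ε) hg] with x hx hx'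
  exact integral_sub hx hx'

theorem stronglyMeasurable_torusAvg (hf : StronglyMeasurable f) :
    StronglyMeasurable (torusAvg ν ε f) :=
  (hf.comp_measurable (measurable_translate_prod ε)).integral_prod_right'

/-- Fubini and translation invariance move the average onto `ψ`, whose periodicity absorbs `reduce`.
-/
theorem integral_torusAvg_mul {f ψ : E n → ℝ} (hf : Integrable f (boxMeasure n))
    (hψ : Continuous ψ) (hp : IsPeriodic ψ) :
    ∫ x, torusAvg ν ε f x * ψ x ∂boxMeasure n =
      ∫ s, ∫ y, f y * ψ (y + ε • s) ∂boxMeasure n ∂ν := by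
  obtain ⟨C, hC⟩ := exists_bound_of_continuous hψ
  have hint : Integrable (fun p : E n × E n => f (reduce (p.1 - ε • p.2)) * ψ p.1)
      ((boxMeasure n).prod ν) :=
    (integrable_translate_prod hf).mul_bdd
      (hψ.comp continuous_fst).aestronglyMeasurable
      (Measure.quasiMeasurePreserving_fst.ae hC)
  simp only [torusAvg, ← integral_mul_const]
  rw [integral_integral_swap hint]
  refine integral_congr_ae (Eventually.of_forall fun s => ?_)
  have hmp := measurePreserving_translate (ε • s)
  have hm : AEStronglyMeasurable (fun y => f y * ψ (y + ε • s)) (boxMeasure n) :=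
    hf.1.mul (by fun_prop : Continuous fun y => ψ (y + ε • s)).aestronglyMeasurable
  have h1 := integral_map hmp.measurable.aemeasurable (hmp.map_eq.symm ▸ hm)
  rw [hmp.map_eq] at h1
  simp only [h1]
  refine integral_congr_ae (Eventually.of_forall fun x => ?_)
  have h2 : ψ (reduce (x - ε • s) + ε • s) = ψ x := by
    have h3 := hp (reduce (x - ε • s) + ε • s) _ (sub_reduce_mem_lattice (x - ε • s))
    rw [← h3]
    congr 1
    abel
  simp only [h2]

theorem IsTest.translate {ψ : E n → ℝ} (hψ : IsTest ψ) (v : E n) : IsTest fun x => ψ (x + v) :=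
  ⟨hψ.1.comp (contDiff_id.add contDiff_const), fun x w hw => by
    simp only [add_right_comm x w v, hψ.2 _ w hw]⟩

theorem partialDeriv_translate (i : Fin n) (ψ : E n → ℝ) (v x : E n) :
    partialDeriv i (fun y => ψ (y + v)) x = partialDeriv i ψ (x + v) := by
  rw [partialDeriv, partialDeriv, fderiv_comp_add_right]

theorem IsTest.isPeriodic_partialDeriv {ψ : E n → ℝ} (hψ : IsTest ψ) (i : Fin n) :
    IsPeriodic (partialDeriv i ψ) := fun x v hv => by
  rw [← partialDeriv_translate, show (fun y => ψ (y + v)) = ψ from funext fun y => hψ.2 y v hv]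

theorem torusAvg_apply_ae {g : E n → E n} (hg : Integrable g (boxMeasure n)) (i : Fin n) :
    (fun x => torusAvg ν ε g x i) =ᵐ[boxMeasure n] torusAvg ν ε fun x => g x i := by
  filter_upwards [ae_integrable_translate (ν := ν) (ε := ε) hg] with x hx
  exact ((EuclideanSpace.proj (𝕜 := ℝ) i).integral_comp_comm hx).symm

/-- Averaging commutes with weak differentiation. -/
theorem IsWeakGrad.torusAvg {u v : L2 n} {g : E n → E n} (h : IsWeakGrad u g)
    (hv : v =ᵐ[boxMeasure n] torusAvg ν ε u) :
    IsWeakGrad v (DegenerateEnergy.torusAvg ν ε g) := by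
  refine ⟨integrable_torusAvg h.1, fun ψ hψ i => ?_⟩
  have h1 : ∫ x, v x * partialDeriv i ψ x ∂boxMeasure n =
      ∫ x, DegenerateEnergy.torusAvg ν ε u x * partialDeriv i ψ x ∂boxMeasure n := by
    refine integral_congr_ae ?_
    filter_upwards [hv] with x hx
    rw [hx]
  have h2 : ∫ x, DegenerateEnergy.torusAvg ν ε g x i * ψ x ∂boxMeasure n =
      ∫ x, DegenerateEnergy.torusAvg ν ε (fun x => g x i) x * ψ x ∂boxMeasure n := by
    refine integral_congr_ae ?_
    filter_upwards [torusAvg_apply_ae (ν := ν) (ε := ε) h.1 i] with x hx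
    rw [hx]
  rw [h1, h2, integral_torusAvg_mul (integrable_L2 u) (hψ.continuous_partialDeriv i)
    (hψ.isPeriodic_partialDeriv i), integral_torusAvg_mul (integrable_coord h.1 i)
    hψ.1.continuous hψ.2, ← integral_neg]
  refine integral_congr_ae (Eventually.of_forall fun s => ?_)
  simp only [← partialDeriv_translate]
  exact h.2 _ (hψ.translate _) i

/-! ### Weighted bounds -/

/-- Cauchy-Schwarz applied to `w^{-1/2} · w^{1/2}‖f‖`. -/
theorem enorm_torusAvg_sq_le {ν : Measure (E n)} (hf : StronglyMeasurable f) {w : E n → ℝ≥0∞} (hw : Measurable w)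
    (hw' : ∀ x, w x ≠ ⊤) {x : E n} (hV : ∫⁻ s, (w (reduce (x - ε • s)))⁻¹ ∂ν ≠ ⊤) :
    ‖torusAvg ν ε f x‖ₑ ^ 2 ≤ (∫⁻ s, (w (reduce (x - ε • s)))⁻¹ ∂ν) *
      ∫⁻ s, w (reduce (x - ε • s)) * ‖f (reduce (x - ε • s))‖ₑ ^ 2 ∂ν := by
  have hS := measurable_translate_right ε x
  have hwS : Measurable fun s => w (reduce (x - ε • s)) := hw.comp hS
  have hfS : Measurable fun s => ‖f (reduce (x - ε • s))‖ₑ := hf.enorm.comp hS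
  set a : E n → ℝ≥0∞ := fun s => ((w (reduce (x - ε • s)))⁻¹) ^ (1 / 2 : ℝ) with ha
  set b : E n → ℝ≥0∞ := fun s =>
    (w (reduce (x - ε • s))) ^ (1 / 2 : ℝ) * ‖f (reduce (x - ε • s))‖ₑ with hb
  -- Finiteness of the integral of `w⁻¹` excludes zeros of `w`, so the two factors cancel almost
  -- everywhere.
  have hpos : ∀ᵐ s ∂ν, w (reduce (x - ε • s)) ≠ 0 := by
    filter_upwards [ae_lt_top hwS.inv hV] with s hs h0
    simp [h0] at hs
  have h1 : ‖torusAvg ν ε f x‖ₑ ≤ ∫⁻ s, (a * b) s ∂ν := by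
    refine (enorm_integral_le_lintegral_enorm _).trans (lintegral_mono_ae ?_)
    filter_upwards [hpos] with s hs
    rw [Pi.mul_apply, ha, hb, ← mul_assoc, ← ENNReal.mul_rpow_of_nonneg _ _ (by norm_num),
      ENNReal.inv_mul_cancel hs (hw' _), ENNReal.one_rpow, one_mul]
  have h2 := ENNReal.lintegral_mul_le_Lp_mul_Lq ν Real.HolderConjugate.two_two
    (hwS.inv.pow_const _).aemeasurable ((hwS.pow_const _).mul hfS).aemeasurable (f := a) (g := b)
  have h3 : ∀ t : ℝ≥0∞, (t ^ (1 / 2 : ℝ)) ^ (2 : ℝ) = t := fun t => by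
    rw [← ENNReal.rpow_mul]; norm_num
  have h4 : ∀ s, a s ^ (2 : ℝ) = (w (reduce (x - ε • s)))⁻¹ := fun s => h3 _
  have h5 : ∀ s, b s ^ (2 : ℝ) =
      w (reduce (x - ε • s)) * ‖f (reduce (x - ε • s))‖ₑ ^ 2 := fun s => by
    rw [hb, ENNReal.mul_rpow_of_nonneg _ _ (by norm_num), h3, ENNReal.rpow_two]
  simp only [h4, h5] at h2
  calc ‖torusAvg ν ε f x‖ₑ ^ 2 ≤ (∫⁻ s, (a * b) s ∂ν) ^ 2 := by gcongr
    _ ≤ _ := by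
      refine (pow_le_pow_left₀ zero_le h2 2).trans_eq ?_
      rw [← ENNReal.rpow_two, ENNReal.mul_rpow_of_nonneg _ _ (by norm_num), h3, h3]

/-- The pointwise bound integrated over the torus. The separate outer weight `c` serves two
purposes: `c = w` gives boundedness on `L²(w)`, and `c = 1` gives unweighted square integrability.
-/
theorem lintegral_enorm_torusAvg_sq_le (hf : StronglyMeasurable f) {w c : E n → ℝ≥0∞}
    (hw : Measurable w) (hw' : ∀ x, w x ≠ ⊤) {K : ℝ≥0∞}
    (hV : ∀ x ∈ box n, ∫⁻ s, (w (reduce (x - ε • s)))⁻¹ ∂ν ≠ ⊤)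
    (hK : ∀ x ∈ box n, c x * ∫⁻ s, (w (reduce (x - ε • s)))⁻¹ ∂ν ≤ K) :
    ∫⁻ x, c x * ‖torusAvg ν ε f x‖ₑ ^ 2 ∂boxMeasure n ≤
      K * ∫⁻ x, w x * ‖f x‖ₑ ^ 2 ∂boxMeasure n := by
  have hm : Measurable fun x => w x * ‖f x‖ₑ ^ 2 := hw.mul (hf.enorm.pow_const 2)
  have hmS := hm.comp (measurable_translate_prod (n := n) ε)
  simp only [Function.comp_def] at hmS
  rw [← (measurePreserving_translate_prod ν ε).lintegral_comp hm, lintegral_prod _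
    hmS.aemeasurable, ← lintegral_const_mul _ hmS.lintegral_prod_right']
  refine lintegral_mono_ae ?_
  filter_upwards [ae_mem_box n] with x hx
  refine (mul_le_mul_right (enorm_torusAvg_sq_le hf hw hw' (hV x hx)) (c x)).trans ?_
  rw [← mul_assoc]
  exact mul_le_mul_left (hK x hx) _

theorem lintegral_withDensity_enorm_sq {G : Type*} [NormedAddCommGroup G] {f : E n → G}
    {μ : Measure (E n)} {w : E n → ℝ≥0∞} (hw : Measurable w)
    (hf : StronglyMeasurable f) :
    ∫⁻ x, ‖f x‖ₑ ^ 2 ∂μ.withDensity w = ∫⁻ x, w x * ‖f x‖ₑ ^ 2 ∂μ :=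
  lintegral_withDensity_eq_lintegral_mul _ hw (hf.enorm.pow_const 2)

theorem eLpNorm_two_eq {α G : Type*} [NormedAddCommGroup G] {m : MeasurableSpace α}
    (μ : Measure α) (f : α → G) :
    eLpNorm f 2 μ = (∫⁻ x, ‖f x‖ₑ ^ 2 ∂μ) ^ (1 / 2 : ℝ) := by
  rw [eLpNorm_eq_lintegral_rpow_enorm_toReal (by norm_num) (by norm_num)]
  simp

theorem eLpNorm_torusAvg_le (hf : StronglyMeasurable f) {w : E n → ℝ≥0∞}
    (hw : Measurable w) (hw' : ∀ x, w x ≠ ⊤) {K : ℝ≥0∞}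
    (hV : ∀ x ∈ box n, ∫⁻ s, (w (reduce (x - ε • s)))⁻¹ ∂ν ≠ ⊤)
    (hK : ∀ x ∈ box n, w x * ∫⁻ s, (w (reduce (x - ε • s)))⁻¹ ∂ν ≤ K) :
    eLpNorm (torusAvg ν ε f) 2 ((boxMeasure n).withDensity w) ≤
      K ^ (1 / 2 : ℝ) * eLpNorm f 2 ((boxMeasure n).withDensity w) := by
  rw [eLpNorm_two_eq, eLpNorm_two_eq, lintegral_withDensity_enorm_sq hw hf,
    lintegral_withDensity_enorm_sq hw (stronglyMeasurable_torusAvg hf),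
    ← ENNReal.mul_rpow_of_nonneg _ _ (by norm_num)]
  exact ENNReal.rpow_le_rpow (lintegral_enorm_torusAvg_sq_le hf hw hw' hV hK) (by norm_num)

/-! ### Convergence of the averages -/

/-- The open box is needed because `reduce` jumps across the faces. -/
theorem tendsto_reduce {ε : ℕ → ℝ} (hε : Tendsto ε atTop (𝓝 0)) {x : E n}
    (hx : x ∈ openBox n) (s : E n) :
    Tendsto (fun m => reduce (x - ε m • s)) atTop (𝓝 x) := by
  have h : Tendsto (fun m => x - ε m • s) atTop (𝓝 x) := by
    simpa using (hε.smul_const s).const_sub x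
  refine h.congr' ?_
  filter_upwards [h.eventually ((isOpen_openBox n).mem_nhds hx)] with m hm
  exact (reduce_of_mem_box (openBox_subset_box n hm)).symm

theorem tendsto_torusAvg_of_continuous [CompleteSpace F] {ε : ℕ → ℝ}
    (hε : Tendsto ε atTop (𝓝 0)) (h : BoundedContinuousFunction (E n) F) {x : E n}
    (hx : x ∈ openBox n) : Tendsto (fun m => torusAvg ν (ε m) h x) atTop (𝓝 (h x)) := by
  have h1 : Tendsto (fun m => torusAvg ν (ε m) h x) atTop (𝓝 (∫ _, h x ∂ν)) := by
    refine tendsto_integral_of_dominated_convergence (fun _ => ‖h‖) (fun m => ?_)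
      (integrable_const _) (fun m => Eventually.of_forall fun s => h.norm_coe_le_norm _)
      (Eventually.of_forall fun s =>
        (h.continuous.tendsto x).comp (tendsto_reduce hε hx s))
    exact (h.continuous.stronglyMeasurable.comp_measurable
      (measurable_translate_right _ _)).aestronglyMeasurable
  simpa using h1

theorem norm_torusAvg_le (h : BoundedContinuousFunction (E n) F) (x : E n) :
    ‖torusAvg ν ε h x‖ ≤ ‖h‖ := by
  refine (norm_integral_le_of_norm_le_const (μ := ν) (C := ‖h‖)
    (Eventually.of_forall fun s => h.norm_coe_le_norm (reduce (x - ε • s)))).trans_eq ?_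
  simp

/-- Dominated convergence. Since `h` need not be periodic, pointwise convergence is only available
in the open box, which has full measure. -/
theorem tendsto_eLpNorm_torusAvg_of_continuous [CompleteSpace F] {ε : ℕ → ℝ}
    (hε : Tendsto ε atTop (𝓝 0)) (h : BoundedContinuousFunction (E n) F) {μ : Measure (E n)}
    [IsFiniteMeasure μ] (hμ : μ ≪ boxMeasure n) :
    Tendsto (fun m => eLpNorm (torusAvg ν (ε m) ⇑h - ⇑h) 2 μ) atTop (𝓝 0) := by
  simp only [eLpNorm_two_eq]
  have h1 : Tendsto (fun m => ∫⁻ x, ‖(torusAvg ν (ε m) ⇑h - ⇑h) x‖ₑ ^ 2 ∂μ) atTop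
      (𝓝 (∫⁻ _, 0 ∂μ)) := by
    refine tendsto_lintegral_of_dominated_convergence (fun _ => (2 * ‖h‖ₑ) ^ 2) (fun m => ?_)
      (fun m => Eventually.of_forall fun x => ?_) (by simp [ENNReal.mul_eq_top]) ?_
    · exact (((stronglyMeasurable_torusAvg h.continuous.stronglyMeasurable).sub
        h.continuous.stronglyMeasurable).enorm.pow_const 2)
    · have h2 : ‖(torusAvg ν (ε m) ⇑h - ⇑h) x‖ₑ ≤ 2 * ‖h‖ₑ := by
        refine (enorm_sub_le).trans ?_
        rw [two_mul]
        exact add_le_add (enorm_le_iff_norm_le.2 (norm_torusAvg_le h x))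
          (enorm_le_iff_norm_le.2 (h.norm_coe_le_norm x))
      exact pow_le_pow_left₀ zero_le h2 2
    · filter_upwards [hμ.ae_le (ae_mem_openBox n)] with x hx
      have h3 := ((tendsto_torusAvg_of_continuous (ν := ν) hε h hx).sub_const (h x)).enorm
      simpa using ENNReal.Tendsto.pow (n := 2) h3
  simpa using h1.ennrpow_const (1 / 2 : ℝ)

/-- Averages over small translations converge in weighted `L²` spaces whose weight `w` satisfies
a uniform `A₁` type bound for `w⁻¹`. -/
theorem tendsto_eLpNorm_torusAvg [CompleteSpace F] {ε : ℕ → ℝ} (hε : Tendsto ε atTop (𝓝 0))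
    (hf : StronglyMeasurable f) (hfi : Integrable f (boxMeasure n)) {w : E n → ℝ≥0∞}
    (hw : Measurable w) (hw' : ∀ x, w x ≠ ⊤) (hwi : ∫⁻ x, w x ∂boxMeasure n ≠ ⊤)
    (hf2 : eLpNorm f 2 ((boxMeasure n).withDensity w) ≠ ⊤) {K : ℝ≥0∞} (hK' : K ≠ ⊤)
    (hV : ∀ᶠ m in atTop, ∀ x ∈ box n, ∫⁻ s, (w (reduce (x - ε m • s)))⁻¹ ∂ν ≠ ⊤)
    (hK : ∀ᶠ m in atTop, ∀ x ∈ box n, w x * ∫⁻ s, (w (reduce (x - ε m • s)))⁻¹ ∂ν ≤ K) :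
    Tendsto (fun m => eLpNorm (torusAvg ν (ε m) f - f) 2 ((boxMeasure n).withDensity w))
      atTop (𝓝 0) := by
  set μ := (boxMeasure n).withDensity w with hμ
  have hfin : IsFiniteMeasure μ := isFiniteMeasure_withDensity hwi
  have hac : μ ≪ boxMeasure n := withDensity_absolutelyContinuous _ _
  set L : ℝ≥0∞ := K ^ (1 / 2 : ℝ) with hL
  have hLt : L ≠ ⊤ := ENNReal.rpow_ne_top_of_nonneg (by norm_num) hK'
  rw [ENNReal.tendsto_nhds_zero]
  intro η hη
  -- The approximation error enters twice: averaged, at the cost of a factor `L`, and unaveraged.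
  -- Hence `L + 1`.
  have hδ : η / 2 / (L + 1) ≠ 0 := by
    simp [ENNReal.div_eq_zero_iff, hη.ne', hLt]
  obtain ⟨h, hh, -⟩ := MemLp.exists_boundedContinuous_eLpNorm_sub_le (μ := μ) (p := 2)
    (by norm_num) (f := f) ⟨hf.aestronglyMeasurable, hf2.lt_top⟩ hδ
  have hhm : StronglyMeasurable h := h.continuous.stronglyMeasurable
  have hhi : Integrable h (boxMeasure n) :=
    Integrable.of_bound hhm.aestronglyMeasurable ‖h‖ (Eventually.of_forall h.norm_coe_le_norm)
  have hη2 : (0 : ℝ≥0∞) < η / 2 := ENNReal.half_pos hη.ne'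
  filter_upwards [hV, hK, (ENNReal.tendsto_nhds_zero.1
    (tendsto_eLpNorm_torusAvg_of_continuous (ν := ν) hε h hac)) _ hη2] with m hVm hKm hm
  have e : torusAvg ν (ε m) f - f =ᵐ[μ]
      torusAvg ν (ε m) (f - ⇑h) + ((torusAvg ν (ε m) ⇑h - ⇑h) + (⇑h - f)) := by
    filter_upwards [hac.ae_le (torusAvg_sub_ae (ν := ν) (ε := ε m) hfi hhi)] with x hx
    simp only [Pi.add_apply, hx, Pi.sub_apply]
    abel
  have hA := (stronglyMeasurable_torusAvg (ν := ν) (ε := ε m) (hf.sub hhm)).aestronglyMeasurable (μ := μ)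
  have hB := ((stronglyMeasurable_torusAvg (ν := ν) (ε := ε m) hhm).sub hhm).aestronglyMeasurable (μ := μ)
  have hC := (hhm.sub hf).aestronglyMeasurable (μ := μ)
  calc eLpNorm (torusAvg ν (ε m) f - f) 2 μ
      ≤ eLpNorm (torusAvg ν (ε m) (f - ⇑h)) 2 μ +
        (eLpNorm (torusAvg ν (ε m) ⇑h - ⇑h) 2 μ + eLpNorm (⇑h - f) 2 μ) := by
        rw [eLpNorm_congr_ae e]
        exact (eLpNorm_add_le hA (hB.add hC) (by norm_num)).trans
          (add_le_add le_rfl (eLpNorm_add_le hB hC (by norm_num)))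
    _ ≤ L * (η / 2 / (L + 1)) + (η / 2 + η / 2 / (L + 1)) := by
        gcongr
        · exact (eLpNorm_torusAvg_le (hf.sub hhm) hw hw' hVm hKm).trans (by gcongr)
        · rwa [eLpNorm_sub_comm]
    _ = η / 2 + (L + 1) * (η / 2 / (L + 1)) := by ring
    _ = η := by
        rw [ENNReal.mul_div_cancel (by simp) (by simp [hLt]), ENNReal.add_halves]

end Average

/-! ### Sets covered by finitely many Lipschitz graphs -/

/-- Lipschitz functions of the form `x_i - f(x)`, where `f` does not depend on `x_i`. -/
def IsGraphFunction (h : E n → ℝ) : Prop :=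
  (∃ C, LipschitzWith C h) ∧
    ∃ i : Fin n, ∀ x t, h (x + t • EuclideanSpace.single i 1) = h x + t

/-- Sets covered by the zero sets of finitely many graph functions. -/
def IsGraphCovered (S : Set (E n)) : Prop :=
  ∃ J : Set (E n → ℝ), J.Finite ∧ (∀ h ∈ J, IsGraphFunction h) ∧ ∀ x ∈ S, ∃ h ∈ J, h x = 0

theorem isGraphCovered_empty : IsGraphCovered (∅ : Set (E n)) :=
  ⟨∅, finite_empty, by simp, by simp⟩

theorem IsGraphCovered.mono {S T : Set (E n)} (hT : IsGraphCovered T) (h : S ⊆ T) :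
    IsGraphCovered S := by
  obtain ⟨J, hJ, h1, h2⟩ := hT
  exact ⟨J, hJ, h1, fun x hx => h2 x (h hx)⟩

theorem IsGraphCovered.union {S T : Set (E n)} (hS : IsGraphCovered S) (hT : IsGraphCovered T) :
    IsGraphCovered (S ∪ T) := by
  obtain ⟨J, hJ, h1, h2⟩ := hS
  obtain ⟨J', hJ', h1', h2'⟩ := hT
  refine ⟨J ∪ J', hJ.union hJ', fun h hh => hh.elim (h1 h) (h1' h), fun x hx => ?_⟩
  rcases hx with hx | hx
  · obtain ⟨h, hh, h0⟩ := h2 x hx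
    exact ⟨h, Or.inl hh, h0⟩
  · obtain ⟨h, hh, h0⟩ := h2' x hx
    exact ⟨h, Or.inr hh, h0⟩

theorem IsGraphCovered.biUnion {ι : Type*} {I : Set ι} (hI : I.Finite) {S : ι → Set (E n)}
    (hS : ∀ i ∈ I, IsGraphCovered (S i)) : IsGraphCovered (⋃ i ∈ I, S i) := by
  induction I, hI using Set.Finite.induction_on with
  | empty => simpa using isGraphCovered_empty
  | insert _ _ ih =>
    rw [biUnion_insert]
    exact (hS _ (mem_insert _ _)).union (ih fun i hi => hS i (mem_insert_of_mem _ hi))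

theorem IsGraphFunction.translate {h : E n → ℝ} (hh : IsGraphFunction h) (v : E n) :
    IsGraphFunction fun x => h (x - v) := by
  obtain ⟨⟨C, hC⟩, i, hi⟩ := hh
  refine ⟨⟨C, LipschitzWith.of_dist_le_mul fun x y => ?_⟩, i, fun x t => ?_⟩
  · simpa using hC.dist_le_mul (x - v) (y - v)
  · simp only [add_sub_right_comm x _ v, hi]

theorem IsGraphCovered.translate {S : Set (E n)} (hS : IsGraphCovered S) (v : E n) :
    IsGraphCovered {x | x - v ∈ S} := by
  obtain ⟨J, hJ, h1, h2⟩ := hS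
  refine ⟨(fun h x => h (x - v)) '' J, hJ.image _, ?_, fun x hx => ?_⟩
  · rintro _ ⟨h, hh, rfl⟩
    exact (h1 h hh).translate v
  · obtain ⟨h, hh, h0⟩ := h2 _ hx
    exact ⟨_, ⟨h, hh, rfl⟩, h0⟩

/-! ### Graph coverings of the periodized degeneration set -/

theorem isGraphCovered_singleton (i : Fin n) (p : E n) : IsGraphCovered {p} := by
  refine ⟨{fun x => x i - p i}, finite_singleton _, ?_, by simp⟩
  rintro h rfl
  refine ⟨⟨1, LipschitzWith.of_dist_le_mul fun x y => ?_⟩, i, fun x t => ?_⟩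
  · simpa [Real.dist_eq, dist_eq_norm] using PiLp.norm_apply_le (x - y) i
  · simp; ring

theorem finite_lattice_inter (R : ℝ) : (lattice n ∩ Metric.closedBall 0 R).Finite := by
  obtain ⟨N, hN⟩ := exists_nat_ge R
  refine ((finite_Icc (fun _ : Fin n => -(N : ℤ)) (fun _ => (N : ℤ))).image fun k : Fin n → ℤ =>
    (WithLp.toLp 2 fun i => 2 * (k i : ℝ) : E n)).subset ?_
  rintro v ⟨⟨k, hk⟩, hv⟩
  refine ⟨k, ?_, by ext i; simp [hk i]⟩
  have h : ∀ i, |(k i : ℝ)| ≤ N := fun i => by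
    have h1 := (PiLp.norm_apply_le v i).trans ((mem_closedBall_zero_iff.1 hv).trans hN)
    rw [hk i, Real.norm_eq_abs, abs_mul, abs_two] at h1
    linarith [abs_nonneg (k i : ℝ)]
  exact ⟨fun i => by exact_mod_cast (abs_le.1 (h i)).1, fun i => by
    exact_mod_cast (abs_le.1 (h i)).2⟩

/-- The union of the lattice translates of `Γ`. -/
def periodization (Γ : Set (E n)) : Set (E n) := {y | ∃ p ∈ Γ, y - p ∈ lattice n}

/-- Only finitely many lattice translates of a bounded set meet a given ball. -/
theorem isGraphCovered_periodization_inter {Γ S : Set (E n)} (hS : IsGraphCovered S)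
    (hb : Bornology.IsBounded S) (h : periodization Γ ⊆ periodization S) (R : ℝ) :
    IsGraphCovered (periodization Γ ∩ Metric.closedBall 0 R) := by
  obtain ⟨r, hr⟩ := hb.subset_closedBall 0
  refine (IsGraphCovered.biUnion (finite_lattice_inter (R + r)) (S := fun v => {x | x - v ∈ S})
    fun v _ => hS.translate v).mono ?_
  rintro x ⟨hx, hxR⟩
  obtain ⟨p, hp, hv⟩ := h hx
  simp only [mem_iUnion]
  refine ⟨x - p, ⟨hv, ?_⟩, by simpa using hp⟩
  rw [mem_closedBall_zero_iff] at hxR ⊢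
  exact (norm_sub_le _ _).trans (add_le_add hxR (mem_closedBall_zero_iff.1 (hr hp)))

/-- If the `a`-th velocity component is nonzero, strict differentiability bounds increments of `γ_a`
below by a multiple of the parameter increments. So `γ_b` is locally a Lipschitz function of `γ_a`,
and the arc is a Lipschitz graph. -/
theorem exists_isGraphCovered_image_of_deriv_ne_zero {γ : ℝ → E 2} (hγ : ContDiff ℝ ∞ γ) {t : ℝ}
    (ht : deriv γ t ≠ 0) : ∃ U ∈ 𝓝 t, IsGraphCovered (γ '' U) := by
  obtain ⟨a, ha⟩ : ∃ a, deriv γ t a ≠ 0 := by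
    by_contra! h
    exact ht (by ext i; simpa using h i)
  obtain ⟨b, hab⟩ := exists_ne a
  have hs : HasStrictDerivAt γ (deriv γ t) t := hγ.contDiffAt.hasStrictDerivAt (by simp)
  have hsi : ∀ i, HasStrictDerivAt (fun s => γ s i) (deriv γ t i) t := fun i =>
    (EuclideanSpace.proj (𝕜 := ℝ) i).hasStrictFDerivAt.comp_hasStrictDerivAt t hs
  obtain ⟨K, U₁, hU₁, hK⟩ := (hsi b).hasStrictFDerivAt.exists_lipschitzOnWith
  have h2 := ((hsi a).hasStrictFDerivAt.isLittleO.def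
    (half_pos (norm_pos_iff.2 ha)))
  rw [nhds_prod_eq] at h2
  obtain ⟨U₂, hU₂, h3⟩ := mem_prod_self_iff.1 h2
  set m : ℝ := ‖deriv γ t a‖ / 2 with hm
  have hm0 : 0 < m := half_pos (norm_pos_iff.2 ha)
  have hlow : ∀ x ∈ U₂, ∀ y ∈ U₂, m * |x - y| ≤ |γ x a - γ y a| := fun x hx y hy => by
    have h4 := h3 (mk_mem_prod hx hy)
    simp only [mem_ofPred_eq, ContinuousLinearMap.toSpanSingleton_apply, smul_eq_mul, Real.norm_eq_abs] at h4
    have h5 : |(x - y) * deriv γ t a| = 2 * m * |x - y| := by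
      rw [abs_mul, hm, Real.norm_eq_abs]; ring
    have h6 := abs_sub_abs_le_abs_sub ((x - y) * deriv γ t a) (γ x a - γ y a)
    rw [abs_sub_comm ((x - y) * deriv γ t a)] at h6
    linarith
  set U := U₁ ∩ U₂ with hU
  have hinj : InjOn (fun s => γ s a) U := fun x hx y hy hxy => by
    have h4 := hlow x hx.2 y hy.2
    simp only at hxy
    rw [hxy, sub_self, abs_zero] at h4
    exact sub_eq_zero.1 (abs_eq_zero.1 (le_antisymm
      (nonpos_of_mul_nonpos_right h4 hm0) (abs_nonneg _)))
  have hL : LipschitzOnWith (K / m.toNNReal)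
      (fun y => γ (Function.invFunOn (fun s => γ s a) U y) b) ((fun s => γ s a) '' U) := by
    refine LipschitzOnWith.of_dist_le_mul ?_
    rintro _ ⟨x, hx, rfl⟩ _ ⟨y, hy, rfl⟩
    simp only [hinj.leftInvOn_invFunOn hx, hinj.leftInvOn_invFunOn hy]
    have h4 := hK.dist_le_mul x hx.1 y hy.1
    have h5 := hlow x hx.2 y hy.2
    simp only [Real.dist_eq] at h4 ⊢
    rw [NNReal.coe_div, Real.coe_toNNReal m hm0.le, div_mul_eq_mul_div, le_div_iff₀ hm0]
    nlinarith [K.2, mul_le_mul_of_nonneg_left h5 K.2]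
  -- Extending to all of `ℝ` makes the graph function `x_b - F(x_a)` global.
  obtain ⟨F, hF, hFeq⟩ := hL.extend_real
  refine ⟨U, inter_mem hU₁ hU₂, {fun x => x b - F (x a)}, finite_singleton _, ?_, ?_⟩
  · rintro h rfl
    refine ⟨⟨_, (EuclideanSpace.proj (𝕜 := ℝ) b).lipschitz.sub
      (hF.comp (EuclideanSpace.proj (𝕜 := ℝ) a).lipschitz)⟩, b, fun x s => ?_⟩
    have : (EuclideanSpace.single b (1 : ℝ) : E 2) a = 0 := by simp [hab.symm]
    simp only [PiLp.add_apply, PiLp.smul_apply, this, smul_eq_mul, mul_zero, add_zero]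
    simp
    ring
  · rintro _ ⟨x, hx, rfl⟩
    refine ⟨_, rfl, ?_⟩
    have h4 := hFeq (mem_image_of_mem (fun s => γ s a) hx)
    simp only [hinj.leftInvOn_invFunOn hx] at h4
    simp only [← h4, sub_self]

theorem IsDegenerationSet.isGraphCovered {Γ : Set (E n)} (hΓ : IsDegenerationSet n Γ) (R : ℝ) :
    IsGraphCovered (periodization Γ ∩ Metric.closedBall 0 R) := by
  rcases hΓ with ⟨rfl, rfl⟩ | ⟨rfl, γ, hγ, hd, hinj, rfl⟩
  · have hfin : {x : E 1 | (∀ i, x i = 1 / 2) ∨ (∀ i, x i = -(1 / 2))} ⊆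
        {WithLp.toLp 2 fun _ => 1 / 2} ∪ {WithLp.toLp 2 fun _ => -(1 / 2)} := by
      rintro x (hx | hx)
      · exact Or.inl (by ext i; exact hx i)
      · exact Or.inr (by ext i; exact hx i)
    exact isGraphCovered_periodization_inter
      (((isGraphCovered_singleton 0 _).union (isGraphCovered_singleton 0 _)).mono hfin)
      (((finite_singleton _).union (finite_singleton _)).isBounded.subset hfin) le_rfl R
  · have hc : IsGraphCovered (γ '' Icc 0 1) := by
      refine isCompact_Icc.induction_on (p := fun s => IsGraphCovered (γ '' s)) ?_ ?_ ?_ ?_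
      · simpa using isGraphCovered_empty
      · exact fun s t hst ht => ht.mono (image_mono hst)
      · intro s t hs ht
        rw [image_union]
        exact hs.union ht
      · intro t _
        obtain ⟨U, hU, h⟩ := exists_isGraphCovered_image_of_deriv_ne_zero hγ (hd t)
        exact ⟨U, mem_nhdsWithin_of_mem_nhds hU, h⟩
    refine isGraphCovered_periodization_inter hc (isCompact_Icc.image hγ.continuous).isBounded ?_ R
    rintro x ⟨_, ⟨t, rfl⟩, hx⟩
    -- Parameters differing by an integer give the same torus point, so one period suffices.
    refine ⟨γ (Int.fract t), ⟨_, ⟨Int.fract_nonneg t, (Int.fract_lt_one t).le⟩, rfl⟩, ?_⟩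
    have h := (hinj t (Int.fract t)).2 ⟨⌊t⌋, Int.self_sub_fract t⟩
    simpa using add_mem_lattice hx h

/-- A graph function vanishing at a nearby point of the periodized `Γ` is controlled at `x` by its
Lipschitz constant times the distance. -/
theorem exists_graphFunction_le_torusDist {Γ : Set (E n)} (hΓ : IsDegenerationSet n Γ) (R : ℝ) :
    ∃ (J : Finset (E n → ℝ)) (C : ℝ), 0 < C ∧ (∀ h ∈ J, IsGraphFunction h) ∧
      ∀ x, ‖x‖ ≤ R → torusDist Γ x < 1 → ∃ h ∈ J, |h x| ≤ C * torusDist Γ x := by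
  -- Points at distance less than one from the ball of radius `R` must also be covered.
  obtain ⟨J, hJ, h1, h2⟩ := hΓ.isGraphCovered (R + 1)
  have h3 : ∀ h : E n → ℝ, ∃ C : NNReal, h ∈ J → LipschitzWith C h := fun h => by
    by_cases hh : h ∈ J
    · obtain ⟨⟨C, hC⟩, -⟩ := h1 h hh
      exact ⟨C, fun _ => hC⟩
    · exact ⟨0, fun hh' => absurd hh' hh⟩
  choose L hL using h3
  set C : ℝ := ∑ h ∈ hJ.toFinset, (L h : ℝ) + 1 with hC
  have hC0 : 0 < C := add_pos_of_nonneg_of_pos (Finset.sum_nonneg fun h _ => (L h).2) one_pos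
  have hLC : ∀ h ∈ J, (L h : ℝ) ≤ C := fun h hh =>
    (Finset.single_le_sum (f := fun h => (L h : ℝ)) (fun h _ => (L h).2)
      (hJ.mem_toFinset.2 hh)).trans (le_add_of_nonneg_right zero_le_one)
  have hne : (periodization Γ).Nonempty := by
    have : Γ.Nonempty := by
      rcases hΓ with ⟨rfl, rfl⟩ | ⟨rfl, γ, -, -, -, rfl⟩
      · exact ⟨WithLp.toLp 2 fun _ => 1 / 2, Or.inl fun _ => rfl⟩
      · exact range_nonempty γ
    obtain ⟨p, hp⟩ := this
    exact ⟨p, p, hp, by simpa using zero_mem_lattice⟩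
  have key : ∀ x, ‖x‖ ≤ R → ∀ r ≤ 1, torusDist Γ x < r → ∃ h ∈ J, |h x| < C * r := by
    intro x hx r hr hd
    obtain ⟨p, hp, hxp⟩ := (Metric.infDist_lt_iff hne).1 hd
    obtain ⟨h, hh, h0⟩ := h2 p ⟨hp, by
      rw [mem_closedBall_zero_iff]
      have := norm_le_norm_add_norm_sub' p x
      rw [← dist_eq_norm] at this
      rw [dist_comm] at hxp
      linarith⟩
    refine ⟨h, hh, ?_⟩
    have h4 := (hL h hh).dist_le_mul x p
    rw [h0, Real.dist_eq, sub_zero] at h4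
    exact h4.trans_lt ((mul_le_mul_of_nonneg_right (hLC h hh) dist_nonneg).trans_lt
      (mul_lt_mul_of_pos_left hxp hC0))
  refine ⟨hJ.toFinset, C, hC0, fun h hh => h1 h (hJ.mem_toFinset.1 hh), fun x hx hd => ?_⟩
  obtain ⟨h', hh', -⟩ := key x hx 1 le_rfl hd
  -- In `key` the function depends on `r`. The minimizer of `|h x|` over the finite family works for
  -- every `r`, so `r` can decrease to the distance.
  obtain ⟨h₀, hh₀, hmin⟩ := exists_min_image J (fun h => |h x|) hJ ⟨h', hh'⟩
  refine ⟨h₀, hJ.mem_toFinset.2 hh₀, ?_⟩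
  by_contra! hlt
  have hlt' : torusDist Γ x < min 1 (|h₀ x| / C) :=
    lt_min hd ((lt_div_iff₀ hC0).2 (by linarith))
  obtain ⟨h, hh, hlt₂⟩ := key x hx _ (min_le_left _ _) hlt'
  have h5 : C * min 1 (|h₀ x| / C) ≤ |h₀ x| :=
    (mul_le_mul_of_nonneg_left (min_le_right _ _) hC0.le).trans_eq (mul_div_cancel₀ _ hC0.ne')
  exact absurd (hmin h hh) (not_le.2 (hlt₂.trans_le h5))

/-! ### Integrals of negative powers of graph functions -/

/-- The function `|t|^{-σ}` with values in `[0,∞]`. -/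
def invPow (σ t : ℝ) : ℝ≥0∞ := (ENNReal.ofReal |t| ^ σ)⁻¹

theorem measurable_invPow (σ : ℝ) : Measurable (invPow σ) := by
  unfold invPow
  fun_prop

theorem invPow_le_one {σ t : ℝ} (hσ : 0 ≤ σ) (ht : 1 ≤ |t|) : invPow σ t ≤ 1 := by
  rw [invPow, ENNReal.inv_le_one]
  simpa using ENNReal.rpow_le_rpow (ENNReal.one_le_ofReal.2 ht) hσ

theorem invPow_mul {σ : ℝ} (hσ : 0 ≤ σ) {a : ℝ} (ha : 0 < a) (t : ℝ) :
    invPow σ (a * t) = invPow σ a * invPow σ t := by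
  have h1 : ENNReal.ofReal |a| ^ σ ≠ 0 := by
    simp [ENNReal.rpow_eq_zero_iff, ha.ne']
  have h2 : ENNReal.ofReal |a| ^ σ ≠ ⊤ := ENNReal.rpow_ne_top_of_nonneg hσ ENNReal.ofReal_ne_top
  rw [invPow, abs_mul, ENNReal.ofReal_mul (abs_nonneg _), ENNReal.mul_rpow_of_nonneg _ _ hσ,
    ENNReal.mul_inv (Or.inl h1) (Or.inl h2)]
  rfl

theorem lintegral_invPow_Ioc_lt_top {σ : ℝ} (hσ1 : σ < 1) :
    ∫⁻ t in Ioc 0 1, invPow σ t < ⊤ := by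
  have h := (intervalIntegral.intervalIntegrable_rpow' (a := 0) (b := 1) (r := -σ)
    (by linarith)).1
  refine lt_of_le_of_lt ?_ h.2
  refine setLIntegral_mono' measurableSet_Ioc fun t ht => le_of_eq ?_
  rw [invPow, abs_of_pos ht.1, ENNReal.ofReal_rpow_of_pos ht.1,
    ← ENNReal.ofReal_inv_of_pos (Real.rpow_pos_of_pos ht.1 _), ← Real.rpow_neg ht.1.le,
    Real.enorm_of_nonneg (Real.rpow_nonneg ht.1.le _)]

theorem lintegral_invPow_Ioo_lt_top {σ : ℝ} (hσ1 : σ < 1) :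
    ∫⁻ t in Ioo (-1) 1, invPow σ t < ⊤ := by
  have h1 : ∫⁻ t in Ico (-1) 0, invPow σ t = ∫⁻ t in Ioc 0 1, invPow σ t := by
    have h := (Measure.measurePreserving_neg (volume : Measure ℝ)).setLIntegral_comp_preimage
      (s := Ioc 0 1) measurableSet_Ioc (measurable_invPow σ)
    rw [← h]
    simp [invPow]
  have h0 : ∫⁻ t in ({0} : Set ℝ), invPow σ t = 0 :=
    setLIntegral_measure_zero _ _ (by simp)
  have hsub : Ioo (-1 : ℝ) 1 ⊆ Ico (-1) 0 ∪ ({0} ∪ Ioc 0 1) := by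
    intro t ht
    rcases lt_trichotomy t 0 with h | h | h
    · exact Or.inl ⟨ht.1.le, h⟩
    · exact Or.inr (Or.inl h)
    · exact Or.inr (Or.inr ⟨h, ht.2.le⟩)
  refine (lintegral_mono_set hsub).trans_lt ((lintegral_union_le _ _ _).trans_lt ?_)
  refine ENNReal.add_lt_top.2 ⟨h1 ▸ lintegral_invPow_Ioc_lt_top hσ1,
    (lintegral_union_le _ _ _).trans_lt ?_⟩
  rw [h0, zero_add]
  exact lintegral_invPow_Ioc_lt_top hσ1

/-- Uniform in `a`: the part with `|a + t| < 1` is at most the full singular integral, and elsewhere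
the integrand is at most one. -/
theorem lintegral_invPow_add_le {σ : ℝ} (hσ : 0 ≤ σ) (a : ℝ) :
    ∫⁻ t in Icc 0 1, invPow σ (a + t) ≤ (∫⁻ t in Ioo (-1) 1, invPow σ t) + 1 := by
  have h : ∀ t, invPow σ t ≤ (Ioo (-1) 1).indicator (invPow σ) t + 1 := fun t => by
    by_cases ht : t ∈ Ioo (-1 : ℝ) 1
    · rw [indicator_of_mem ht]
      exact le_self_add
    · refine (invPow_le_one hσ ?_).trans le_add_self
      by_contra! hlt
      exact ht (abs_lt.1 hlt)
  calc ∫⁻ t in Icc 0 1, invPow σ (a + t)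
      ≤ ∫⁻ t in Icc (0 : ℝ) 1, ((Ioo (-1) 1).indicator (invPow σ) (a + t) + 1) :=
        lintegral_mono fun t => h _
    _ = (∫⁻ t in Icc (0 : ℝ) 1, (Ioo (-1) 1).indicator (invPow σ) (a + t)) + 1 := by
        rw [lintegral_add_right _ measurable_const]
        simp
    _ ≤ (∫⁻ t, (Ioo (-1) 1).indicator (invPow σ) (a + t)) + 1 := by
        gcongr
        exact Measure.restrict_le_self
    _ = _ := by
        rw [lintegral_add_left_eq_self (fun t => (Ioo (-1) 1).indicator (invPow σ) t) a,
          lintegral_indicator measurableSet_Ioo]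

/-- Shifting by `t • e` with `0 ≤ t ≤ 1` replaces `H` by `H + t` and enlarges the ball by one.
Averaging over `t` and exchanging integrals reduces to one dimension, with no change of variables
and no Lipschitz constant in the bound. -/
theorem lintegral_invPow_comp_le {σ : ℝ} (hσ : 0 ≤ σ) {H : E n → ℝ} (hH : Measurable H)
    {e : E n} (he : ‖e‖ ≤ 1) (hHe : ∀ x t, H (x + t • e) = H x + t) (R : ℝ) :
    ∫⁻ x in Metric.closedBall 0 R, invPow σ (H x) ≤
      ((∫⁻ t in Ioo (-1) 1, invPow σ t) + 1) * volume (Metric.closedBall (0 : E n) (R + 1)) := by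
  have hm : Measurable fun p : ℝ × E n => invPow σ (H p.2 + p.1) :=
    (measurable_invPow σ).comp (by fun_prop)
  have hshift : ∀ t ∈ Icc (0 : ℝ) 1, ∫⁻ x in Metric.closedBall 0 R, invPow σ (H x) ≤
      ∫⁻ x in Metric.closedBall 0 (R + 1), invPow σ (H x + t) := fun t ht => by
    rw [← lintegral_indicator Metric.isClosed_closedBall.measurableSet,
      ← lintegral_indicator Metric.isClosed_closedBall.measurableSet,
      ← lintegral_add_right_eq_self _ (t • e)]
    refine lintegral_mono fun x => ?_
    by_cases hx : x + t • e ∈ Metric.closedBall (0 : E n) R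
    · have hx' : x ∈ Metric.closedBall (0 : E n) (R + 1) := by
        rw [mem_closedBall_zero_iff] at hx ⊢
        have h1 : ‖t • e‖ ≤ 1 := by
          rw [norm_smul, Real.norm_of_nonneg ht.1]
          exact mul_le_one₀ ht.2 (norm_nonneg _) he
        have h2 := norm_le_norm_add_norm_sub' x (x + t • e)
        rw [show x - (x + t • e) = -(t • e) by abel, norm_neg] at h2
        linarith
      rw [indicator_of_mem hx, indicator_of_mem hx', hHe]
    · rw [indicator_of_notMem hx]
      exact zero_le
  calc ∫⁻ x in Metric.closedBall 0 R, invPow σ (H x)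
      = ∫⁻ _ in Icc (0 : ℝ) 1, ∫⁻ x in Metric.closedBall 0 R, invPow σ (H x) := by simp
    _ ≤ ∫⁻ t in Icc (0 : ℝ) 1, ∫⁻ x in Metric.closedBall 0 (R + 1), invPow σ (H x + t) :=
        setLIntegral_mono' measurableSet_Icc hshift
    _ = ∫⁻ x in Metric.closedBall 0 (R + 1), ∫⁻ t in Icc (0 : ℝ) 1, invPow σ (H x + t) :=
        lintegral_lintegral_swap hm.aemeasurable
    _ ≤ ∫⁻ _ in Metric.closedBall (0 : E n) (R + 1), ((∫⁻ t in Ioo (-1) 1, invPow σ t) + 1) :=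
        lintegral_mono fun x => lintegral_invPow_add_le hσ _
    _ = _ := by simp

/-! ### The weight -/

theorem torusDist_nonneg (Γ : Set (E n)) (x : E n) : 0 ≤ torusDist Γ x := Metric.infDist_nonneg

theorem torusDist_le_add (Γ : Set (E n)) (x y : E n) :
    torusDist Γ x ≤ torusDist Γ y + dist x y := Metric.infDist_le_infDist_add_dist

theorem continuous_torusDist (Γ : Set (E n)) : Continuous (torusDist Γ) :=
  Metric.continuous_infDist_pt _

theorem norm_le_of_mem_box {x : E n} (hx : x ∈ box n) : ‖x‖ ≤ n := by
  rw [EuclideanSpace.norm_eq]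
  refine Real.sqrt_le_iff.2 ⟨n.cast_nonneg, ?_⟩
  have h : ∑ i, ‖x i‖ ^ 2 ≤ ∑ _i : Fin n, (1 : ℝ) := Finset.sum_le_sum fun i _ => by
    rw [Real.norm_eq_abs]
    exact pow_le_one₀ (abs_nonneg _) (abs_le.2 ⟨(hx i).1, (hx i).2.le⟩)
  refine h.trans ?_
  simp only [Finset.sum_const, Finset.card_univ, Fintype.card_fin, nsmul_eq_mul, mul_one]
  exact_mod_cast Nat.le_self_pow two_ne_zero n

/-- Dominate `d^{-σ}` by `1` plus the finitely many terms `C^σ |h|^{-σ}`; after rescaling by `ε`,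
each `h` again has unit slope, so only a factor `ε^{-σ}` appears. -/
theorem exists_lintegral_invPow_torusDist_le {σ : ℝ} (hσ0 : 0 ≤ σ) (hσ1 : σ < 1) {Γ : Set (E n)}
    (hΓ : IsDegenerationSet n Γ) (R : ℝ) : ∃ K : ℝ≥0∞, K ≠ ⊤ ∧
      ∀ ε, 0 < ε → ε ≤ 1 → ∀ x ∈ box n,
        ∫⁻ s in Metric.closedBall 0 R, invPow σ (torusDist Γ (x - ε • s)) ≤ K * invPow σ ε := by
  obtain ⟨J, C, hC, hJ, hle⟩ := exists_graphFunction_le_torusDist hΓ (n + R)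
  set c₀ : ℝ≥0∞ := ENNReal.ofReal |C| ^ σ with hc₀
  have hc₀t : c₀ ≠ ⊤ := ENNReal.rpow_ne_top_of_nonneg hσ0 ENNReal.ofReal_ne_top
  set I : ℝ≥0∞ := ((∫⁻ t in Ioo (-1) 1, invPow σ t) + 1) *
    volume (Metric.closedBall (0 : E n) (R + 1)) with hI
  have hIt : I ≠ ⊤ := ENNReal.mul_ne_top
    (ENNReal.add_ne_top.2 ⟨(lintegral_invPow_Ioo_lt_top hσ1).ne, ENNReal.one_ne_top⟩)
    measure_closedBall_lt_top.ne
  have hpt : ∀ x, ‖x‖ ≤ n + R → invPow σ (torusDist Γ x) ≤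
      1 + ∑ h ∈ J, c₀ * invPow σ (h x) := by
    intro x hx
    rcases le_or_gt 1 (torusDist Γ x) with h1 | h1
    · exact (invPow_le_one hσ0 (h1.trans (le_abs_self _))).trans le_self_add
    · obtain ⟨h, hh, hxh⟩ := hle x hx h1
      have hsum : ∀ f : (E n → ℝ) → ℝ≥0∞, f h ≤ ∑ k ∈ J, f k := fun f =>
        Finset.single_le_sum (fun _ _ => zero_le) hh
      refine le_trans ?_ ((hsum fun h => c₀ * invPow σ (h x)).trans le_add_self)
      have hc₀0 : c₀ ≠ 0 := by simp [hc₀, ENNReal.rpow_eq_zero_iff, hC.ne']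
      have h2 : invPow σ (C * torusDist Γ x) ≤ invPow σ (h x) := by
        refine ENNReal.inv_le_inv.2 (ENNReal.rpow_le_rpow (ENNReal.ofReal_le_ofReal ?_) hσ0)
        rwa [abs_of_nonneg (mul_nonneg hC.le (torusDist_nonneg _ _))]
      rw [invPow_mul hσ0 hC] at h2
      calc invPow σ (torusDist Γ x) = c₀ * (invPow σ C * invPow σ (torusDist Γ x)) := by
            rw [← mul_assoc, show c₀ * invPow σ C = 1 from ENNReal.mul_inv_cancel hc₀0 hc₀t,
              one_mul]
        _ ≤ _ := by gcongr
  refine ⟨volume (Metric.closedBall (0 : E n) R) + ∑ _h ∈ J, c₀ * I, ?_, ?_⟩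
  · exact ENNReal.add_ne_top.2 ⟨measure_closedBall_lt_top.ne,
      (ENNReal.sum_ne_top).2 fun _ _ => ENNReal.mul_ne_top hc₀t hIt⟩
  intro ε hε hε1 x hx
  have hone : 1 ≤ invPow σ ε := by
    rw [invPow, ENNReal.one_le_inv]
    exact ENNReal.rpow_le_one (by simpa [abs_of_pos hε] using hε1) hσ0
  have hterm : ∀ h ∈ J, ∫⁻ s in Metric.closedBall 0 R, c₀ * invPow σ (h (x - ε • s)) ≤
      c₀ * I * invPow σ ε := by
    intro h hh
    obtain ⟨⟨L, hL⟩, i, hi⟩ := hJ h hh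
    -- The factor `-ε⁻¹` restores slope `+1` in the direction `e_i` as a function of `s`.
    have hHm : Measurable fun s : E n => -ε⁻¹ * h (x - ε • s) :=
      ((hL.continuous.comp (by fun_prop : Continuous fun s : E n => x - ε • s)).const_mul
        _).measurable
    have h3 := lintegral_invPow_comp_le hσ0 hHm (e := EuclideanSpace.single i 1) (by simp)
      (fun s t => by
        have : x - ε • (s + t • EuclideanSpace.single i (1 : ℝ)) =
            x - ε • s + (-(ε * t)) • EuclideanSpace.single i 1 := by
          rw [smul_add, smul_smul, neg_smul]; abel
        rw [this, hi]
        field_simp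
        ring) R
    have h4 : ∀ s, invPow σ (h (x - ε • s)) =
        invPow σ ε * invPow σ (-ε⁻¹ * h (x - ε • s)) := fun s => by
      rw [← invPow_mul hσ0 hε, ← mul_assoc, mul_neg, mul_inv_cancel₀ hε.ne', neg_one_mul,
        invPow, invPow, abs_neg]
    simp only [h4]
    have hm : Measurable fun s => invPow σ (-ε⁻¹ * h (x - ε • s)) := (measurable_invPow σ).comp hHm
    rw [lintegral_const_mul _ (hm.const_mul _), lintegral_const_mul _ hm, mul_assoc, mul_comm I]
    gcongr
  have hmeas : ∀ h ∈ J, Measurable fun s => c₀ * invPow σ (h (x - ε • s)) := fun h hh => by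
    obtain ⟨⟨L, hL⟩, -⟩ := hJ h hh
    exact ((measurable_invPow σ).comp
      (hL.continuous.comp (by fun_prop : Continuous fun s : E n => x - ε • s)).measurable).const_mul _
  calc ∫⁻ s in Metric.closedBall 0 R, invPow σ (torusDist Γ (x - ε • s))
      ≤ ∫⁻ s in Metric.closedBall 0 R, (1 + ∑ h ∈ J, c₀ * invPow σ (h (x - ε • s))) := by
        refine setLIntegral_mono' Metric.isClosed_closedBall.measurableSet fun s hs => hpt _ ?_
        refine (norm_sub_le _ _).trans (add_le_add (norm_le_of_mem_box hx) ?_)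
        rw [norm_smul, Real.norm_of_nonneg hε.le]
        exact (mul_le_of_le_one_left (norm_nonneg _) hε1).trans (mem_closedBall_zero_iff.1 hs)
    _ = volume (Metric.closedBall (0 : E n) R) +
        ∑ h ∈ J, ∫⁻ s in Metric.closedBall 0 R, c₀ * invPow σ (h (x - ε • s)) := by
        rw [lintegral_add_left measurable_const, lintegral_finsetSum _ hmeas]
        simp
    _ ≤ volume (Metric.closedBall (0 : E n) R) * invPow σ ε +
        ∑ h ∈ J, c₀ * I * invPow σ ε :=
        add_le_add (le_mul_of_one_le_right zero_le hone) (Finset.sum_le_sum hterm)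
    _ = _ := by rw [add_mul, Finset.sum_mul]

/-! ### From the distance to the diffusivity: averages of `1/α` -/

theorem inv_le_mul_inv_of_le_mul {a b c : ℝ≥0∞} (h0 : c ≠ 0) (ht : c ≠ ⊤) (h : a ≤ c * b) :
    b⁻¹ ≤ c * a⁻¹ := by
  have h1 : b⁻¹ = c * (c * b)⁻¹ := by
    rw [ENNReal.mul_inv (Or.inl h0) (Or.inl ht), ← mul_assoc, ENNReal.mul_inv_cancel h0 ht, one_mul]
  rw [h1]
  gcongr

theorem IsDiffusivity.nonneg {σ : ℝ} {Γ : Set (E n)} {α : E n → ℝ} (hα : IsDiffusivity σ Γ α)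
    (x : E n) : 0 ≤ α x := by
  obtain ⟨c, hc, h⟩ := hα.bounds
  exact (mul_nonneg (by positivity) (Real.rpow_nonneg (torusDist_nonneg _ _) _)).trans (h x).1

theorem IsDiffusivity.exists_ennreal_bounds {σ : ℝ} (hσ0 : 0 ≤ σ) {Γ : Set (E n)} {α : E n → ℝ}
    (hα : IsDiffusivity σ Γ α) : ∃ c : ℝ≥0∞, c ≠ 0 ∧ c ≠ ⊤ ∧ ∀ x,
      ENNReal.ofReal (α x) ≤ c * ENNReal.ofReal (torusDist Γ x) ^ σ ∧
      (ENNReal.ofReal (α x))⁻¹ ≤ c * invPow σ (torusDist Γ x) := by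
  obtain ⟨c, hc, h⟩ := hα.bounds
  have hc0 : 0 < c := by linarith
  have h0 : ENNReal.ofReal c ≠ 0 := by simpa using hc0
  refine ⟨ENNReal.ofReal c, h0, ENNReal.ofReal_ne_top, fun x => ⟨?_, ?_⟩⟩
  · rw [ENNReal.ofReal_rpow_of_nonneg (torusDist_nonneg _ _) hσ0, ← ENNReal.ofReal_mul hc0.le]
    exact ENNReal.ofReal_le_ofReal (h x).2
  · rw [invPow, abs_of_nonneg (torusDist_nonneg _ _)]
    refine inv_le_mul_inv_of_le_mul h0 ENNReal.ofReal_ne_top ?_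
    rw [ENNReal.ofReal_rpow_of_nonneg (torusDist_nonneg _ _) hσ0, ← ENNReal.ofReal_mul hc0.le]
    refine ENNReal.ofReal_le_ofReal ?_
    have := (h x).1
    rw [div_mul_eq_mul_div, one_mul, div_le_iff₀ hc0] at this
    linarith

theorem IsDiffusivity.lintegral_ne_top {σ : ℝ} (hσ0 : 0 ≤ σ) {Γ : Set (E n)} {α : E n → ℝ}
    (hα : IsDiffusivity σ Γ α) : ∫⁻ x, ENNReal.ofReal (α x) ∂boxMeasure n ≠ ⊤ := by
  obtain ⟨c, -, hct, h⟩ := hα.exists_ennreal_bounds hσ0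
  refine ((lintegral_mono_ae (g := fun _ =>
    c * ENNReal.ofReal (torusDist Γ 0 + n) ^ σ) ?_).trans_lt ?_).ne
  · filter_upwards [ae_mem_box n] with x hx
    refine (h x).1.trans ?_
    gcongr
    refine (torusDist_le_add Γ x 0).trans ?_
    rw [dist_zero_right]
    gcongr
    exact norm_le_of_mem_box hx
  · rw [lintegral_const]
    exact ENNReal.mul_lt_top (ENNReal.mul_lt_top hct.lt_top
      (ENNReal.rpow_lt_top_of_nonneg hσ0 ENNReal.ofReal_ne_top)) (measure_lt_top _ _)

/-- The averages of `1/α` over translates of size `ε` are at most of order `ε^{-σ}` and of order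
`1/α`. -/
theorem IsDiffusivity.exists_lintegral_inv_le {σ : ℝ} (hσ0 : 0 ≤ σ) (hσ1 : σ < 1) {Γ : Set (E n)}
    (hΓ : IsDegenerationSet n Γ) {α : E n → ℝ} (hα : IsDiffusivity σ Γ α) {ν : Measure (E n)}
    [IsProbabilityMeasure ν] {R : ℝ} (hR : 0 < R) {M : ℝ≥0∞} (hM : M ≠ ⊤)
    (hν : ν ≤ M • volume.restrict (Metric.closedBall 0 R)) :
    ∃ K : ℝ≥0∞, K ≠ ⊤ ∧ ∀ ε, 0 < ε → ε ≤ 1 → ∀ x ∈ box n,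
      ∫⁻ s, (ENNReal.ofReal (α (reduce (x - ε • s))))⁻¹ ∂ν ≤ K * invPow σ ε ∧
      ENNReal.ofReal (α x) * ∫⁻ s, (ENNReal.ofReal (α (reduce (x - ε • s))))⁻¹ ∂ν ≤ K := by
  obtain ⟨c, -, hct, hc⟩ := hα.exists_ennreal_bounds hσ0
  obtain ⟨K, hK, hle⟩ := exists_lintegral_invPow_torusDist_le hσ0 hσ1 hΓ R
  simp only [hα.periodic.reduce]
  have hp : ∀ a : ℝ, ENNReal.ofReal a ^ σ ≠ ⊤ := fun a =>
    ENNReal.rpow_ne_top_of_nonneg hσ0 ENNReal.ofReal_ne_top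
  have hA : ∀ ε, 0 < ε → ε ≤ 1 → ∀ x ∈ box n,
      ∫⁻ s, (ENNReal.ofReal (α (x - ε • s)))⁻¹ ∂ν ≤ M * c * K * invPow σ ε := by
    intro ε hε hε1 x hx
    have hm : Measurable fun s => invPow σ (torusDist Γ (x - ε • s)) :=
      (measurable_invPow σ).comp ((continuous_torusDist Γ).comp
        (by fun_prop : Continuous fun s : E n => x - ε • s)).measurable
    calc ∫⁻ s, (ENNReal.ofReal (α (x - ε • s)))⁻¹ ∂ν
        ≤ ∫⁻ s, c * invPow σ (torusDist Γ (x - ε • s))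
            ∂(M • volume.restrict (Metric.closedBall 0 R)) :=
          lintegral_mono' hν fun s => (hc _).2
      _ = M * (c * ∫⁻ s in Metric.closedBall 0 R, invPow σ (torusDist Γ (x - ε • s))) := by
          rw [lintegral_smul_measure, lintegral_const_mul _ hm, smul_eq_mul]
      _ ≤ M * (c * (K * invPow σ ε)) := by
          gcongr
          exact hle ε hε hε1 x hx
      _ = _ := by ring
  have hmem : ∀ᵐ s ∂ν, ‖s‖ ≤ R := by
    have h1 : ∀ᵐ s ∂(M • volume.restrict (Metric.closedBall (0 : E n) R)), ‖s‖ ≤ R := by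
      refine Measure.ae_smul_measure ?_ M
      filter_upwards [ae_restrict_mem Metric.isClosed_closedBall.measurableSet] with s hs
      exact mem_closedBall_zero_iff.1 hs
    exact (Measure.absolutelyContinuous_of_le hν).ae_le h1
  -- The summands are the constants of the `ε^{-σ}` bound and of the near and far cases of the `1/α`
  -- bound.
  refine ⟨M * c * K + (c * ENNReal.ofReal (2 * R) ^ σ * (M * c * K) +
    c * c * ENNReal.ofReal 2 ^ σ), ?_, fun ε hε hε1 x hx => ⟨?_, ?_⟩⟩
  · have h1 : M * c * K ≠ ⊤ := ENNReal.mul_ne_top (ENNReal.mul_ne_top hM hct) hK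
    exact ENNReal.add_ne_top.2 ⟨h1, ENNReal.add_ne_top.2
      ⟨ENNReal.mul_ne_top (ENNReal.mul_ne_top hct (hp _)) h1,
        ENNReal.mul_ne_top (ENNReal.mul_ne_top hct hct) (hp _)⟩⟩
  · refine (hA ε hε hε1 x hx).trans ?_
    gcongr
    exact le_self_add
  · refine le_trans ?_ le_add_self
    -- Near `Γ`, `α(x)` is at most of order `ε^σ`, cancelling `ε^{-σ}`. Far from it, a displacement
    -- of at most `R ε` keeps at least half the distance, so the averaged `1/α` is comparable to
    -- `d(x,Γ)^{-σ}`.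
    rcases lt_or_ge (torusDist Γ x) (2 * R * ε) with hd | hd
    · refine le_trans ?_ le_self_add
      have h1 : ENNReal.ofReal ε ^ σ * invPow σ ε = 1 := by
        rw [invPow, abs_of_pos hε]
        exact ENNReal.mul_inv_cancel (by simp [ENNReal.rpow_eq_zero_iff, hε]) (hp _)
      calc ENNReal.ofReal (α x) * ∫⁻ s, (ENNReal.ofReal (α (x - ε • s)))⁻¹ ∂ν
          ≤ (c * ENNReal.ofReal (2 * R * ε) ^ σ) * (M * c * K * invPow σ ε) := by
            refine mul_le_mul' ((hc x).1.trans ?_) (hA ε hε hε1 x hx)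
            gcongr
        _ = c * ENNReal.ofReal (2 * R) ^ σ * (M * c * K) *
              (ENNReal.ofReal ε ^ σ * invPow σ ε) := by
            rw [ENNReal.ofReal_mul (by positivity), ENNReal.mul_rpow_of_nonneg _ _ hσ0]
            ring
        _ = _ := by rw [h1, mul_one]
    · refine le_trans ?_ le_add_self
      have hdx : 0 < torusDist Γ x := lt_of_lt_of_le (by positivity) hd
      have hw : ∫⁻ s, (ENNReal.ofReal (α (x - ε • s)))⁻¹ ∂ν ≤
          ∫⁻ _, c * (ENNReal.ofReal 2 ^ σ * invPow σ (torusDist Γ x)) ∂ν := by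
        refine lintegral_mono_ae ?_
        filter_upwards [hmem] with s hs
        refine (hc _).2.trans (mul_le_mul_right ?_ c)
        have h1 : torusDist Γ x ≤ 2 * torusDist Γ (x - ε • s) := by
          have h2 := torusDist_le_add Γ x (x - ε • s)
          rw [dist_eq_norm, sub_sub_cancel, norm_smul, Real.norm_of_nonneg hε.le] at h2
          nlinarith [mul_le_mul_of_nonneg_left hs hε.le]
        rw [invPow, invPow, abs_of_nonneg (torusDist_nonneg _ _),
          abs_of_nonneg (torusDist_nonneg _ _)]
        refine inv_le_mul_inv_of_le_mul (by simp [ENNReal.rpow_eq_zero_iff]) (hp _) ?_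
        rw [← ENNReal.mul_rpow_of_nonneg _ _ hσ0, ← ENNReal.ofReal_mul zero_le_two]
        gcongr
      have h1 : ENNReal.ofReal (torusDist Γ x) ^ σ * invPow σ (torusDist Γ x) = 1 := by
        rw [invPow, abs_of_pos hdx]
        exact ENNReal.mul_inv_cancel (by simp [ENNReal.rpow_eq_zero_iff, hdx]) (hp _)
      rw [lintegral_const, measure_univ, mul_one] at hw
      calc ENNReal.ofReal (α x) * ∫⁻ s, (ENNReal.ofReal (α (x - ε • s)))⁻¹ ∂ν
          ≤ (c * ENNReal.ofReal (torusDist Γ x) ^ σ) *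
              (c * (ENNReal.ofReal 2 ^ σ * invPow σ (torusDist Γ x))) := mul_le_mul' (hc x).1 hw
        _ = c * c * ENNReal.ofReal 2 ^ σ *
              (ENNReal.ofReal (torusDist Γ x) ^ σ * invPow σ (torusDist Γ x)) := by ring
        _ = _ := by rw [h1, mul_one]

/-! ### Recovery sequences -/

theorem eLpNorm_sqrt_smul {α : E n → ℝ} (hα : Measurable α) (h0 : ∀ x, 0 ≤ α x) {f : E n → E n}
    (hf : StronglyMeasurable f) (μ : Measure (E n)) :
    eLpNorm (fun x => √(α x) • f x) 2 μ =
      eLpNorm f 2 (μ.withDensity fun x => ENNReal.ofReal (α x)) := by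
  rw [eLpNorm_two_eq, eLpNorm_two_eq, lintegral_withDensity_enorm_sq hα.ennreal_ofReal hf]
  congr 1
  refine lintegral_congr fun x => ?_
  rw [enorm_smul, mul_pow, Real.enorm_of_nonneg (Real.sqrt_nonneg _),
    ← ENNReal.ofReal_pow (Real.sqrt_nonneg _), Real.sq_sqrt (h0 x)]

theorem eLpNorm_two_ne_top_iff {F : Type*} [NormedAddCommGroup F] {μ : Measure (E n)}
    {f : E n → F} : eLpNorm f 2 μ ≠ ⊤ ↔ ∫⁻ x, ‖f x‖ₑ ^ 2 ∂μ ≠ ⊤ := by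
  rw [eLpNorm_two_eq, ne_eq, ENNReal.rpow_eq_top_iff_of_pos (by norm_num)]

/-- Averages evaluate the gradient along translates, so an everywhere measurable representative is
convenient. -/
theorem exists_stronglyMeasurable_isWeakGrad {α : E n → ℝ} (u : H1w α) :
    ∃ g, StronglyMeasurable g ∧ IsWeakGrad (u : L2 n) g ∧
      MemLp (fun x => √(α x) • g x) 2 (boxMeasure n) := by
  have h := isWeakGrad_of_H1w u
  refine ⟨h.1.1.mk _, h.1.1.stronglyMeasurable_mk, h.congr h.1.1.ae_eq_mk,
    (memLp_sqrt_smul_weakGrad u).ae_eq ?_⟩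
  filter_upwards [h.1.1.ae_eq_mk] with x hx
  rw [hx]

theorem regEnergy_eq {α : E n → ℝ} (h0 : ∀ x, 0 ≤ α x) (m : ℕ) {u : H1w α}
    (hu : MemH1 (u : L2 n)) {g : E n → E n} (hg : IsWeakGrad (u : L2 n) g) :
    regEnergy α m (u : L2 n) =
      ENNReal.ofReal (1 / m) * ∫⁻ x, ‖g x‖ₑ ^ 2 ∂boxMeasure n + energy α (u : L2 n) := by
  have e : ∀ y : E n, ‖y‖ₑ ^ 2 = ENNReal.ofReal (‖y‖ ^ 2) := fun y => by
    rw [ENNReal.ofReal_pow (norm_nonneg _), ofReal_norm]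
  have hm : AEMeasurable (fun x => ‖g x‖ₑ ^ 2) (boxMeasure n) := hg.1.1.enorm.pow_const 2
  rw [regEnergy, if_pos hu, energy, if_pos u.2, ← lintegral_const_mul'' _ hm,
    ← lintegral_add_left' (hm.const_mul _)]
  refine lintegral_congr_ae ?_
  filter_upwards [hg.weakGrad_ae_eq] with x hx
  rw [hx, e, ← ENNReal.ofReal_mul (by positivity), ← ENNReal.ofReal_add (by positivity)
    (mul_nonneg (h0 x) (sq_nonneg _)), add_mul]

/-- The product equals `m^{-(1-σ)}`: the regularization `1/m` beats the blow-up `m^σ` of the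
unregularized gradient norm. -/
theorem tendsto_ofReal_mul_invPow {σ : ℝ} (hσ1 : σ < 1) :
    Tendsto (fun m : ℕ => ENNReal.ofReal (1 / m) * invPow σ ((m : ℝ)⁻¹)) atTop (𝓝 0) := by
  have h1 : Tendsto (fun m : ℕ => ENNReal.ofReal (((m : ℝ)⁻¹) ^ (1 - σ))) atTop (𝓝 0) := by
    have h2 := (Real.continuousAt_rpow_const 0 (1 - σ) (Or.inr (by linarith))).tendsto.comp
      (tendsto_inv_atTop_nhds_zero_nat (𝕜 := ℝ))
    rw [Real.zero_rpow (by linarith)] at h2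
    simpa using ENNReal.tendsto_ofReal h2
  refine h1.congr' ?_
  filter_upwards [eventually_ge_atTop 1] with m hm
  have hm0 : (0 : ℝ) < (m : ℝ)⁻¹ := inv_pos.2 (by exact_mod_cast hm)
  rw [invPow, abs_of_pos hm0, one_div, ENNReal.ofReal_rpow_of_pos hm0,
    ← ENNReal.ofReal_inv_of_pos (Real.rpow_pos_of_pos hm0 _), ← ENNReal.ofReal_mul hm0.le,
    Real.rpow_sub hm0, Real.rpow_one, div_eq_mul_inv]

theorem memH1_zero : MemH1 (0 : L2 n) := ⟨0, isWeakGrad_zero n, MemLp.zero⟩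

section Recovery

variable {σ : ℝ} {Γ : Set (E n)} {α : E n → ℝ} {ν : Measure (E n)} [IsProbabilityMeasure ν]

theorem lintegral_mul_enorm_sq_ne_top (hα : IsDiffusivity σ Γ α) {g : E n → E n}
    (hgm : StronglyMeasurable g) (hg2 : MemLp (fun x => √(α x) • g x) 2 (boxMeasure n)) :
    ∫⁻ x, ENNReal.ofReal (α x) * ‖g x‖ₑ ^ 2 ∂boxMeasure n ≠ ⊤ := by
  have h := hg2.2.ne
  rwa [eLpNorm_sqrt_smul hα.measurable hα.nonneg hgm, eLpNorm_two_ne_top_iff,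
    lintegral_withDensity_enorm_sq hα.measurable.ennreal_ofReal hgm] at h

theorem memLp_torusAvg_L2 (ε : ℝ) (u : L2 n) : MemLp (torusAvg ν ε u) 2 (boxMeasure n) := by
  have hu := Lp.stronglyMeasurable u
  refine ⟨(stronglyMeasurable_torusAvg hu).aestronglyMeasurable, ?_⟩
  have h := eLpNorm_torusAvg_le (ν := ν) (ε := ε) hu (w := 1) measurable_one (by simp) (K := 1)
    (by simp) (by simp)
  rw [withDensity_one, ENNReal.one_rpow, one_mul] at h
  exact h.trans_lt (Lp.memLp u).2

/-- The constant `K` (outer weight `α`) puts the average in the weighted space; `L` (outer weight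
`1`) puts it in `H¹`. -/
theorem exists_torusAvg_mem (hα : IsDiffusivity σ Γ α) {K : ℝ≥0∞} {ε : ℝ}
    (hV : ∀ x ∈ box n, ∫⁻ s, (ENNReal.ofReal (α (reduce (x - ε • s))))⁻¹ ∂ν ≠ ⊤) (hK' : K ≠ ⊤)
    (hK : ∀ x ∈ box n,
      ENNReal.ofReal (α x) * ∫⁻ s, (ENNReal.ofReal (α (reduce (x - ε • s))))⁻¹ ∂ν ≤ K)
    {L : ℝ≥0∞} (hL' : L ≠ ⊤)
    (hL : ∀ x ∈ box n, ∫⁻ s, (ENNReal.ofReal (α (reduce (x - ε • s))))⁻¹ ∂ν ≤ L)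
    {u : H1w α} {g : E n → E n} (hgm : StronglyMeasurable g) (hg : IsWeakGrad (u : L2 n) g)
    (hg2 : MemLp (fun x => √(α x) • g x) 2 (boxMeasure n)) :
    ∃ v : H1w α, (v : L2 n) =ᵐ[boxMeasure n] torusAvg ν ε (u : L2 n) ∧
      IsWeakGrad (v : L2 n) (torusAvg ν ε g) ∧ MemH1 (v : L2 n) := by
  have hw : Measurable fun x => ENNReal.ofReal (α x) := hα.measurable.ennreal_ofReal
  have hI := lintegral_mul_enorm_sq_ne_top hα hgm hg2
  have hAm : StronglyMeasurable (torusAvg ν ε g) := stronglyMeasurable_torusAvg hgm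
  set v : L2 n := (memLp_torusAvg_L2 (ν := ν) ε (u : L2 n)).toLp _ with hv
  have hvu : v =ᵐ[boxMeasure n] torusAvg ν ε (u : L2 n) := MemLp.coeFn_toLp _
  have hvg : IsWeakGrad v (torusAvg ν ε g) := hg.torusAvg hvu
  have hmem : v ∈ H1w α := by
    refine ⟨_, hvg, ((Real.continuous_sqrt.measurable.comp
      hα.measurable).stronglyMeasurable.smul hAm).aestronglyMeasurable, ?_⟩
    rw [eLpNorm_sqrt_smul hα.measurable hα.nonneg hAm, lt_top_iff_ne_top, eLpNorm_two_ne_top_iff,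
      lintegral_withDensity_enorm_sq hw hAm]
    exact ne_top_of_le_ne_top (ENNReal.mul_ne_top hK' hI)
      (lintegral_enorm_torusAvg_sq_le hgm hw (fun _ => ENNReal.ofReal_ne_top) hV hK)
  refine ⟨⟨v, hmem⟩, hvu, hvg, _, hvg, hAm.aestronglyMeasurable, ?_⟩
  rw [lt_top_iff_ne_top, eLpNorm_two_ne_top_iff]
  have h := lintegral_enorm_torusAvg_sq_le (ν := ν) (ε := ε) hgm hw
    (fun _ => ENNReal.ofReal_ne_top) (c := 1) hV (K := L) (by simpa using hL)
  simp only [Pi.one_apply, one_mul] at h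
  exact ne_top_of_le_ne_top (ENNReal.mul_ne_top hL' hI) h

theorem exists_recovery_sequence (hσ0 : 0 ≤ σ) (hσ1 : σ < 1) (hΓ : IsDegenerationSet n Γ)
    (hα : IsDiffusivity σ Γ α) {R : ℝ} (hR : 0 < R) {M : ℝ≥0∞} (hM : M ≠ ⊤)
    (hν : ν ≤ M • volume.restrict (Metric.closedBall 0 R)) (u : H1w α) :
    ∃ v : ℕ → H1w α,
      (∀ m : ℕ, 1 ≤ m →
        (v m : L2 n) =ᵐ[boxMeasure n] torusAvg ν ((m : ℝ)⁻¹) (u : L2 n)) ∧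
      (∀ m : ℕ, MemH1 (v m : L2 n)) ∧
      Tendsto v atTop (@nhds _ (weakTopology α) u) ∧
      Tendsto (fun m => regEnergy α m (v m)) atTop (𝓝 (energy α u)) := by
  obtain ⟨K, hKt, hK⟩ := hα.exists_lintegral_inv_le hσ0 hσ1 hΓ (ν := ν) hR hM hν
  obtain ⟨g, hgm, hg, hg2⟩ := exists_stronglyMeasurable_isWeakGrad u
  have hw : Measurable fun x => ENNReal.ofReal (α x) := hα.measurable.ennreal_ofReal
  have hI := lintegral_mul_enorm_sq_ne_top hα hgm hg2
  have hε0 : ∀ m : ℕ, 1 ≤ m → 0 < (m : ℝ)⁻¹ := fun m hm => inv_pos.2 (by exact_mod_cast hm)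
  have hε1 : ∀ m : ℕ, 1 ≤ m → (m : ℝ)⁻¹ ≤ 1 := fun m hm => inv_le_one_of_one_le₀ (by exact_mod_cast hm)
  have hKm : ∀ m : ℕ, 1 ≤ m → ∀ x ∈ box n, _ := fun m hm => hK _ (hε0 m hm) (hε1 m hm)
  have hLt : ∀ m : ℕ, 1 ≤ m → K * invPow σ ((m : ℝ)⁻¹) ≠ ⊤ := fun m hm => by
    refine ENNReal.mul_ne_top hKt ?_
    rw [invPow, ENNReal.inv_ne_top]
    have := hε0 m hm
    simp [ENNReal.rpow_eq_zero_iff]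
    grind
  have hVm : ∀ m : ℕ, 1 ≤ m → ∀ x ∈ box n,
      ∫⁻ s, (ENNReal.ofReal (α (reduce (x - (m : ℝ)⁻¹ • s))))⁻¹ ∂ν ≠ ⊤ := fun m hm x hx =>
    ne_top_of_le_ne_top (hLt m hm) (hKm m hm x hx).1
  have hex : ∀ m : ℕ, ∃ v : H1w α, MemH1 (v : L2 n) ∧ (1 ≤ m →
      (v : L2 n) =ᵐ[boxMeasure n] torusAvg ν ((m : ℝ)⁻¹) (u : L2 n) ∧
      IsWeakGrad (v : L2 n) (torusAvg ν ((m : ℝ)⁻¹) g)) := fun m => by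
    by_cases hm : 1 ≤ m
    · obtain ⟨v, h1, h2, h3⟩ := exists_torusAvg_mem hα (hVm m hm) hKt
        (fun x hx => (hKm m hm x hx).2) (hLt m hm) (fun x hx => (hKm m hm x hx).1) hgm hg hg2
      exact ⟨v, h3, fun _ => ⟨h1, h2⟩⟩
    -- The index `m = 0` gets the value zero, which keeps `MemH1` valid for all `m`.
    · exact ⟨0, memH1_zero, fun h => absurd h hm⟩
  choose v hv1 hv2 using hex
  have hεt : Tendsto (fun m : ℕ => (m : ℝ)⁻¹) atTop (𝓝 0) := tendsto_inv_atTop_nhds_zero_nat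
  have hL2 : Tendsto (fun m => (v m : L2 n)) atTop (𝓝 (u : L2 n)) := by
    rw [Lp.tendsto_Lp_iff_tendsto_eLpNorm']
    have h := tendsto_eLpNorm_torusAvg (ν := ν) hεt (Lp.stronglyMeasurable (u : L2 n))
      (integrable_L2 _) (w := 1) measurable_one (by simp) (by simp)
      (by rw [withDensity_one]; exact (Lp.memLp (u : L2 n)).2.ne) (K := 1) (by simp)
      (by simp) (by simp)
    rw [withDensity_one] at h
    refine h.congr' ?_
    filter_upwards [eventually_ge_atTop 1] with m hm
    exact eLpNorm_congr_ae ((hv2 m hm).1.symm.sub (ae_eq_refl _))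
  have hG : Tendsto (fun m => weightedGrad α (v m)) atTop (𝓝 (weightedGrad α u)) := by
    rw [Lp.tendsto_Lp_iff_tendsto_eLpNorm']
    have h := tendsto_eLpNorm_torusAvg (ν := ν) hεt hgm hg.1 hw (fun _ => ENNReal.ofReal_ne_top)
      (hα.lintegral_ne_top hσ0)
      (by rw [← eLpNorm_sqrt_smul hα.measurable hα.nonneg hgm]; exact hg2.2.ne) hKt
      ((eventually_ge_atTop 1).mono hVm)
      ((eventually_ge_atTop 1).mono fun m hm x hx => (hKm m hm x hx).2)
    refine h.congr' ?_
    filter_upwards [eventually_ge_atTop 1] with m hm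
    rw [← eLpNorm_sqrt_smul hα.measurable hα.nonneg
      ((stronglyMeasurable_torusAvg hgm).sub hgm)]
    refine eLpNorm_congr_ae ?_
    filter_upwards [coeFn_weightedGrad (v m), coeFn_weightedGrad u, hg.weakGrad_ae_eq,
      (hv2 m hm).2.weakGrad_ae_eq] with x h1 h2 h3 h4
    rw [Pi.sub_apply, Pi.sub_apply, h1, h2, h3, h4, smul_sub]
  refine ⟨v, fun m hm => (hv2 m hm).1, hv1, tendsto_weakTopology_of_norm hL2 hG, ?_⟩
  have hE : Tendsto (fun m => energy α (v m : L2 n)) atTop (𝓝 (energy α (u : L2 n))) := by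
    simp only [energy_eq hα.nonneg]
    exact ENNReal.tendsto_ofReal (hG.norm.pow 2)
  have hR0 : Tendsto (fun m : ℕ => ENNReal.ofReal (1 / m) *
      ∫⁻ x, ‖torusAvg ν ((m : ℝ)⁻¹) g x‖ₑ ^ 2 ∂boxMeasure n) atTop (𝓝 0) := by
    -- The majorant is `K E_α(u) m^{σ-1}`.
    have hb : Tendsto (fun m : ℕ => (K * ∫⁻ x, ENNReal.ofReal (α x) * ‖g x‖ₑ ^ 2 ∂boxMeasure n) *
        (ENNReal.ofReal (1 / m) * invPow σ ((m : ℝ)⁻¹))) atTop (𝓝 0) := by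
      simpa using ENNReal.Tendsto.const_mul (tendsto_ofReal_mul_invPow hσ1)
        (Or.inr (ENNReal.mul_ne_top hKt hI))
    refine tendsto_of_tendsto_of_tendsto_of_le_of_le' tendsto_const_nhds hb
      (Eventually.of_forall fun _ => zero_le) ?_
    filter_upwards [eventually_ge_atTop 1] with m hm
    have h := lintegral_enorm_torusAvg_sq_le (ν := ν) hgm hw (fun _ => ENNReal.ofReal_ne_top)
      (c := 1) (hVm m hm) (K := K * invPow σ ((m : ℝ)⁻¹))
      (fun x hx => by simpa using (hKm m hm x hx).1)
    simp only [Pi.one_apply, one_mul] at h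
    calc _ ≤ ENNReal.ofReal (1 / m) * (K * invPow σ ((m : ℝ)⁻¹) *
          ∫⁻ x, ENNReal.ofReal (α x) * ‖g x‖ₑ ^ 2 ∂boxMeasure n) := by gcongr
      _ = _ := by ring
  have hsum := hR0.add hE
  rw [zero_add] at hsum
  refine hsum.congr' ?_
  filter_upwards [eventually_ge_atTop 1] with m hm
  exact (regEnergy_eq hα.nonneg m (hv1 m) (hv2 m hm).2).symm

end Recovery

/-! ### Periodic convolution as an average of translates -/

/-- The measure with density `φ`. -/
def profileMeasure (φ : E n → ℝ) : Measure (E n) :=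
  volume.withDensity fun x => ENNReal.ofReal (φ x)

theorem IsMollifierProfile.eq_zero {φ : E n → ℝ} (hφ : IsMollifierProfile φ) {x : E n}
    (hx : x ∉ box n) : φ x = 0 := by
  by_contra h
  exact hx (hφ.support (subset_tsupport _ h))

theorem IsMollifierProfile.isProbabilityMeasure {φ : E n → ℝ} (hφ : IsMollifierProfile φ) :
    IsProbabilityMeasure (profileMeasure φ) := by
  have hi : Integrable φ := by
    by_contra h
    have := hφ.integral_eq_one
    rw [integral_undef h] at this
    exact zero_ne_one this
  refine ⟨?_⟩
  rw [profileMeasure, withDensity_apply _ MeasurableSet.univ, Measure.restrict_univ,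
    ← ofReal_integral_eq_lintegral_ofReal hi (Eventually.of_forall hφ.nonneg),
    hφ.integral_eq_one, ENNReal.ofReal_one]

/-- Radial monotonicity gives `φ ≤ φ 0`, and the box lies in the ball of radius `n`; radius `n + 1`
is positive for every `n`. -/
theorem IsMollifierProfile.profileMeasure_le {φ : E n → ℝ} (hφ : IsMollifierProfile φ) :
    profileMeasure φ ≤
      ENNReal.ofReal (φ 0) • volume.restrict (Metric.closedBall 0 ((n : ℝ) + 1)) := by
  rw [← withDensity_const, profileMeasure,
    ← withDensity_indicator Metric.isClosed_closedBall.measurableSet]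
  refine withDensity_mono (Eventually.of_forall fun x => ?_)
  by_cases hx : x ∈ box n
  · have : x ∈ Metric.closedBall (0 : E n) (n + 1) := by
      rw [mem_closedBall_zero_iff]
      linarith [norm_le_of_mem_box hx]
    simp only [indicator_of_mem this]
    exact ENNReal.ofReal_le_ofReal (hφ.radial_anti _ _ (by simp))
  · simp only [hφ.eq_zero hx, ENNReal.ofReal_zero]
    exact zero_le

theorem integral_reflect {f : E n → ℝ} (hf : Measurable f) (x : E n) :
    ∫ y, f (reduce (x - y)) ∂boxMeasure n = ∫ y, f y ∂boxMeasure n := by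
  have hmp := measurePreserving_reflect x
  conv_rhs => rw [← hmp.map_eq]
  rw [integral_map hmp.measurable.aemeasurable hf.aestronglyMeasurable]

/-- Substitute `y = x - z` on the torus, then `s = m z`, whose Jacobian cancels `mⁿ`. -/
theorem IsMollifierProfile.periodicConv_eq {φ : E n → ℝ} (hφ : IsMollifierProfile φ) {m : ℕ}
    (hm : 1 ≤ m) (u : L2 n) :
    periodicConv (mollifier φ m) u = torusAvg (profileMeasure φ) ((m : ℝ)⁻¹) u := by
  ext x
  have hm1 : (1 : ℝ) ≤ m := by exact_mod_cast hm
  have hm0 : (m : ℝ) ≠ 0 := by positivity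
  have hφc := hφ.smooth.continuous
  have hk : Measurable (mollifier φ m) :=
    (continuous_const.mul (hφc.comp (continuous_const_smul (m : ℝ)))).measurable
  have hum : Measurable u := (Lp.stronglyMeasurable u).measurable
  -- For `m ≥ 1` the support shrinks, so the integral over the box is one over the whole space.
  have h0 : ∀ z, z ∉ box n → mollifier φ m z = 0 := fun z hz => by
    rw [mollifier, hφ.eq_zero, mul_zero]
    refine fun h => hz fun i => ?_
    have hi := h i
    simp only [PiLp.smul_apply, smul_eq_mul] at hi
    constructor
    · by_contra! hlt
      nlinarith [hi.1]
    · by_contra! hlt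
      nlinarith [hi.2]
  calc periodicConv (mollifier φ m) u x
      = ∫ z, mollifier φ m (reduce (x - reduce (x - z))) * u (reduce (x - z)) ∂boxMeasure n :=
        (integral_reflect (f := fun y => mollifier φ m (reduce (x - y)) * u y)
          ((hk.comp (measurable_reduce.comp (by fun_prop))).mul hum) x).symm
    _ = ∫ z in box n, mollifier φ m z * u (reduce (x - z)) := by
        refine integral_congr_ae ?_
        filter_upwards [ae_mem_box n] with z hz
        rw [reduce_sub_reduce, sub_sub_cancel, reduce_of_mem_box hz]
    _ = ∫ z, mollifier φ m z * u (reduce (x - z)) :=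
        setIntegral_eq_integral_of_forall_compl_eq_zero fun z hz => by rw [h0 z hz, zero_mul]
    _ = (m : ℝ) ^ n * ∫ z, φ ((m : ℝ) • z) * u (reduce (x - (m : ℝ)⁻¹ • ((m : ℝ) • z))) := by
        rw [← integral_const_mul]
        simp only [mollifier, inv_smul_smul₀ hm0, mul_assoc]
    _ = ∫ s, φ s * u (reduce (x - (m : ℝ)⁻¹ • s)) := by
        rw [Measure.integral_comp_smul volume
          (fun s => φ s * u (reduce (x - (m : ℝ)⁻¹ • s))) (m : ℝ), finrank_euclideanSpace_fin,
          abs_of_nonneg (by positivity), smul_eq_mul, mul_inv_cancel_left₀ (pow_ne_zero _ hm0)]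
    _ = _ := by
        rw [torusAvg, profileMeasure, integral_withDensity_eq_integral_toReal_smul
          hφc.measurable.ennreal_ofReal (Eventually.of_forall fun _ => ENNReal.ofReal_lt_top)]
        simp only [ENNReal.toReal_ofReal (hφ.nonneg _), smul_eq_mul]

end DegenerateEnergy

end

/-! ### The Γ-convergence theorem -/

theorem mainTheorem3 (n : ℕ) (σ : ℝ) (hσ0 : 0 ≤ σ) (hσ1 : σ < 1)
    (Γ : Set (DegenerateEnergy.E n)) (hΓ : DegenerateEnergy.IsDegenerationSet n Γ)
    (α : DegenerateEnergy.E n → ℝ) (hα : DegenerateEnergy.IsDiffusivity σ Γ α) :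
    DegenerateEnergy.GammaConverges (DegenerateEnergy.weakTopology α)
      (fun m (u : DegenerateEnergy.H1w α) => DegenerateEnergy.regEnergy α m u)
      (fun u : DegenerateEnergy.H1w α => DegenerateEnergy.energy α u) ∧
    ∀ φ : DegenerateEnergy.E n → ℝ, DegenerateEnergy.IsMollifierProfile φ →
      ∀ u : DegenerateEnergy.H1w α, ∃ v : ℕ → DegenerateEnergy.H1w α,
        (∀ m : ℕ, 1 ≤ m →
          ((v m : DegenerateEnergy.L2 n) : DegenerateEnergy.E n → ℝ)
              =ᵐ[DegenerateEnergy.boxMeasure n]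
            DegenerateEnergy.periodicConv (DegenerateEnergy.mollifier φ m) u) ∧
        (∀ m : ℕ, DegenerateEnergy.MemH1 (v m : DegenerateEnergy.L2 n)) ∧
        Tendsto v atTop (@nhds _ (DegenerateEnergy.weakTopology α) u) ∧
        Tendsto (fun m => DegenerateEnergy.regEnergy α m (v m)) atTop
          (𝓝 (DegenerateEnergy.energy α u)) := by
  refine ⟨⟨fun u v h => DegenerateEnergy.energy_le_liminf hα.nonneg h, fun u => ?_⟩,
    fun φ hφ u => ?_⟩
  -- Bare existence needs no smooth profile: averaging over a normalized ball suffices.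
  · set B : Set (DegenerateEnergy.E n) := Metric.closedBall 0 1
    have hB0 : volume B ≠ 0 := (Metric.measure_closedBall_pos volume 0 one_pos).ne'
    have hBt : volume B ≠ ⊤ := measure_closedBall_lt_top.ne
    have : IsProbabilityMeasure ((volume B)⁻¹ • volume.restrict B) :=
      ⟨by simp [ENNReal.inv_mul_cancel hB0 hBt]⟩
    obtain ⟨v, -, -, h1, h2⟩ := DegenerateEnergy.exists_recovery_sequence hσ0 hσ1 hΓ hα one_pos
      (ENNReal.inv_ne_top.2 hB0) le_rfl u
    exact ⟨v, h1, h2⟩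
  · have := hφ.isProbabilityMeasure
    obtain ⟨v, h1, h2⟩ := DegenerateEnergy.exists_recovery_sequence hσ0 hσ1 hΓ hα
      (by positivity) ENNReal.ofReal_ne_top hφ.profileMeasure_le u
    exact ⟨v, fun m hm => by rw [hφ.periodicConv_eq hm]; exact h1 m hm, h2⟩
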